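/- **Setting.** Let $K\subseteq\mathbb{R}^n$ be the closure of a bounded open set, with Lebesgue measure $dx$, and let $d$ be a metric on $K$ that is continuous on $K\times K$. Let $N\ge 1$ and let $x_1,\dots,x_N\in K$ be such that $\{y\in K: d(y,x_i)-d(y,x_j)=t\}$ has Lebesgue measure zero for all $i\neq j$ and all $t\in\mathbb{R}$. Let $p$ be a continuous, strictly positive probability density on $K$, let $\delta>0$, and let $\mu=\frac1N\sum_{i=1}^N\delta_{x_i}$. Densities are functions $q\in L^1(K,dx)$ with $q\ge 0$ a.e. and $\int_K q\,dx=1$, and are identified if they agree a.e. For $q\in L^1(K,dx)$ with $q\ge0$ a.e. put $H(q,p)=\int_K \log\left(\frac{q}{p}\right)q\,dx\in(-\infty,+\infty]$. Let $\mathcal W(q,\mu)=\inf_\pi\int_{K\times K} d\,d\pi$, over all couplings $\pi$ of $q\,dx$ and $\mu$, be the Wasserstein distance, and let $B_\delta(\mu)$ be the set of densities $q$ with $\mathcal W(q,\mu)\le\delta$. Let $\Lambda=\{\lambda\in\mathbb{R}^N:\sum_i\lambda_i=0\}$ and, for $\lambda\in\Lambda$, $$\phi_\lambda(y)=\min_{1\le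 i\le N}\{d(y,x_i)-\lambda_i\},\qquad \Omega(\lambda)=\Big\{q \text{ density}:\int_K\phi_\lambda q\,dx\le\delta\Big\},\qquad \Gamma(\lambda)=\min\{H(q,p):q\in\Omega(\lambda)\},$$ $$R_i(\lambda)=\{y\in K:\ d(y,x_i)-\lambda_i\le d(y,x_j)-\lambda_j\ \text{ for all } j\},\qquad \overline q_{\lambda,u,v}(y)=p(y)\exp[-1-v\phi_\lambda(y)-u].$$ **Theorem 1.3.** 1. For every $\lambda\in\Lambda$ the minimum defining $\Gamma(\lambda)$ is attained, and the strong Lagrange dual of $\Gamma(\lambda)$ is the concave two-dimensional problem $$\max_{(u,v)\in\mathbb{R}^2,\ v\ge0}\Big(-u-v\delta-\int_K p(y)e^{-(1+v\phi_\lambda(y)+u)}dy\Big).$$ That is, for all $u\in\mathbb{R}$ and $v\ge0$ the infimum of $H(q,p)+v\left(\int_K\phi_\lambda q\,dx-\delta\right)+u\left(\int_K q\,dx-1\right)$ over all $q\in L^1(K,dx)$ with $q\ge0$ a.e. equals this objective at $(u,v)$; the objective is concave on $\{v\ge 0\}$; its maximum is attained; and the maximum equals $\Gamma(\lambda)$.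 2. Assume $\mathcal W(p,\mu)>\delta$. Let $\lambda\in\Lambda$, let $(\overline u,\overline v)$ be a maximizer of the problem in (1), and let $g_i=\frac1N-\int_{R_i(\lambda)}\overline q_{\lambda,\overline u,\overline v}\,dx$ for $i=1,\dots,N$. Then every maximizer of $\Gamma$ on $\Lambda$ lies in $\{\lambda'\in\Lambda:\langle g,\lambda'-\lambda\rangle\ge0\}$. 3. $\Gamma$ is quasi-concave on $\Lambda$. Assume $\mathcal W(p,\mu)>\delta$. Then there is exactly one triple $(\lambda^*,u^*,v^*)\in\Lambda\times\mathbb{R}\times\mathbb{R}$ such that $\overline q_{\lambda^*,u^*,v^*}$ is the unique minimizer of $H(\cdot,p)$ on $B_\delta(\mu)$, and this $\lambda^*$ is the unique maximizer of $\Gamma$ on $\Lambda$. -/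

import Mathlib

open MeasureTheory
open scoped ENNReal

namespace MinCrossEntropy

noncomputable section

/-- `K` is a regular compact set: the closure of a bounded open subset of `ℝⁿ`. -/
def IsRegularCompact {n : ℕ} (K : Set (EuclideanSpace ℝ (Fin n))) : Prop :=
  ∃ U : Set (EuclideanSpace ℝ (Fin n)), IsOpen U ∧ Bornology.IsBounded U ∧ K = closure U

/-- `d` restricts to a metric on `K` that is continuous on `K × K`. (Values of `d` outside
`K × K` play no role; non-negativity on `K` follows from the other axioms.) -/
structure IsContinuousMetricOn {n : ℕ} (K : Set (EuclideanSpace ℝ (Fin n)))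
    (d : EuclideanSpace ℝ (Fin n) → EuclideanSpace ℝ (Fin n) → ℝ) : Prop where
  eq_zero_iff : ∀ y ∈ K, ∀ z ∈ K, d y z = 0 ↔ y = z
  symm : ∀ y ∈ K, ∀ z ∈ K, d y z = d z y
  triangle : ∀ y ∈ K, ∀ z ∈ K, ∀ w ∈ K, d y w ≤ d y z + d z w
  continuousOn : ContinuousOn
    (fun z : EuclideanSpace ℝ (Fin n) × EuclideanSpace ℝ (Fin n) => d z.1 z.2) (K ×ˢ K)

/-- The cone of Lebesgue integrable functions on `K` that are nonnegative a.e. on `K`. -/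
def nonnegCone {n : ℕ} (K : Set (EuclideanSpace ℝ (Fin n))) :
    Set (EuclideanSpace ℝ (Fin n) → ℝ) :=
  {q | IntegrableOn q K volume ∧ ∀ᵐ y ∂(volume.restrict K), 0 ≤ q y}

/-- Probability densities on `K` with respect to Lebesgue measure. -/
def densities {n : ℕ} (K : Set (EuclideanSpace ℝ (Fin n))) :
    Set (EuclideanSpace ℝ (Fin n) → ℝ) :=
  {q | q ∈ nonnegCone K ∧ ∫ y in K, q y = 1}

/-- The measure `q dx` on `K`. -/
def densityMeasure {n : ℕ} (K : Set (EuclideanSpace ℝ (Fin n)))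
    (q : EuclideanSpace ℝ (Fin n) → ℝ) : Measure (EuclideanSpace ℝ (Fin n)) :=
  (volume.restrict K).withDensity (fun y => ENNReal.ofReal (q y))

/-- The empirical measure `(1/N) ∑ δ_{xᵢ}`. -/
def empiricalMeasure {n N : ℕ} (x : Fin N → EuclideanSpace ℝ (Fin n)) :
    Measure (EuclideanSpace ℝ (Fin n)) :=
  (N : ℝ≥0∞)⁻¹ • ∑ i, Measure.dirac (x i)

/-- The Wasserstein distance of two probability measures carried by `K`: the infimum of
`∫_{K×K} d dπ` over all measures `π` whose two marginals are `ν` and `η`. -/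
def wasserstein {n : ℕ} (K : Set (EuclideanSpace ℝ (Fin n)))
    (d : EuclideanSpace ℝ (Fin n) → EuclideanSpace ℝ (Fin n) → ℝ)
    (ν η : Measure (EuclideanSpace ℝ (Fin n))) : ℝ≥0∞ :=
  ⨅ (π : Measure (EuclideanSpace ℝ (Fin n) × EuclideanSpace ℝ (Fin n)))
    (_ : π.map Prod.fst = ν ∧ π.map Prod.snd = η),
    ∫⁻ z in K ×ˢ K, ENNReal.ofReal (d z.1 z.2) ∂π

/-- The probability densities on `K` in the closed Wasserstein ball of radius `δ` around the
empirical measure of `x`. -/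
def wassersteinBall {n N : ℕ} (K : Set (EuclideanSpace ℝ (Fin n)))
    (d : EuclideanSpace ℝ (Fin n) → EuclideanSpace ℝ (Fin n) → ℝ)
    (x : Fin N → EuclideanSpace ℝ (Fin n)) (δ : ℝ) : Set (EuclideanSpace ℝ (Fin n) → ℝ) :=
  {q | q ∈ densities K ∧
    wasserstein K d (densityMeasure K q) (empiricalMeasure x) ≤ ENNReal.ofReal δ}

open Classical in
/-- The relative entropy `H(q,p) = ∫_K log(q/p) q dx`, for nonnegative `q ∈ L¹(K)` and a positive
density `p`. Since `q log(q/p) ≥ -p/e`, the negative part of the integrand is integrable, so the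
integral is `+∞` exactly when the integrand is not integrable. -/
def crossEntropy {n : ℕ} (K : Set (EuclideanSpace ℝ (Fin n)))
    (q p : EuclideanSpace ℝ (Fin n) → ℝ) : EReal :=
  if IntegrableOn (fun y => Real.log (q y / p y) * q y) K volume then
    ((∫ y in K, Real.log (q y / p y) * q y : ℝ) : EReal)
  else ⊤

/-- `φ_lam(y) = minᵢ (d(y, xᵢ) - lamᵢ)`. -/
def phi {n N : ℕ} (d : EuclideanSpace ℝ (Fin n) → EuclideanSpace ℝ (Fin n) → ℝ)
    (x : Fin N → EuclideanSpace ℝ (Fin n)) (lam : Fin N → ℝ)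
    (y : EuclideanSpace ℝ (Fin n)) : ℝ :=
  ⨅ i, (d y (x i) - lam i)

/-- The space `Λ` of weight vectors with sum zero. -/
def weightSpace (N : ℕ) : Set (Fin N → ℝ) := {lam | ∑ i, lam i = 0}

/-- `Ω(lam)`: the probability densities `q` on `K` with `∫_K φ_lam q ≤ δ`. -/
def feasibleSet {n N : ℕ} (K : Set (EuclideanSpace ℝ (Fin n)))
    (d : EuclideanSpace ℝ (Fin n) → EuclideanSpace ℝ (Fin n) → ℝ)
    (x : Fin N → EuclideanSpace ℝ (Fin n)) (δ : ℝ) (lam : Fin N → ℝ) :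
    Set (EuclideanSpace ℝ (Fin n) → ℝ) :=
  {q | q ∈ densities K ∧ ∫ y in K, phi d x lam y * q y ≤ δ}

/-- `Γ(lam)`: the infimum of `H(q,p)` over `q ∈ Ω(lam)`. -/
def Gam {n N : ℕ} (K : Set (EuclideanSpace ℝ (Fin n)))
    (d : EuclideanSpace ℝ (Fin n) → EuclideanSpace ℝ (Fin n) → ℝ)
    (x : Fin N → EuclideanSpace ℝ (Fin n)) (p : EuclideanSpace ℝ (Fin n) → ℝ) (δ : ℝ)
    (lam : Fin N → ℝ) : EReal :=
  ⨅ q ∈ feasibleSet K d x δ lam, crossEntropy K q p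

/-- The Lagrangian of the problem `Γ(lam)`, with multiplier `v ≥ 0` for the constraint
`∫ φ_lam q - δ ≤ 0` and multiplier `u` for the constraint `∫ q - 1 = 0`. -/
def lagrangian {n N : ℕ} (K : Set (EuclideanSpace ℝ (Fin n)))
    (d : EuclideanSpace ℝ (Fin n) → EuclideanSpace ℝ (Fin n) → ℝ)
    (x : Fin N → EuclideanSpace ℝ (Fin n)) (p : EuclideanSpace ℝ (Fin n) → ℝ) (δ : ℝ)
    (lam : Fin N → ℝ) (q : EuclideanSpace ℝ (Fin n) → ℝ) (u v : ℝ) : EReal :=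
  crossEntropy K q p +
    ((v * ((∫ y in K, phi d x lam y * q y) - δ) + u * ((∫ y in K, q y) - 1) : ℝ) : EReal)

/-- The Lagrange dual function of `Γ(lam)`: the infimum of the Lagrangian over the cone of
nonnegative integrable functions on `K`. -/
def dualFunction {n N : ℕ} (K : Set (EuclideanSpace ℝ (Fin n)))
    (d : EuclideanSpace ℝ (Fin n) → EuclideanSpace ℝ (Fin n) → ℝ)
    (x : Fin N → EuclideanSpace ℝ (Fin n)) (p : EuclideanSpace ℝ (Fin n) → ℝ) (δ : ℝ)
    (lam : Fin N → ℝ) (u v : ℝ) : EReal :=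
  ⨅ q ∈ nonnegCone K, lagrangian K d x p δ lam q u v

/-- The function `q̄(y) = p(y) exp(-1 - v φ_lam(y) - u)`. -/
def expDensity {n N : ℕ} (d : EuclideanSpace ℝ (Fin n) → EuclideanSpace ℝ (Fin n) → ℝ)
    (x : Fin N → EuclideanSpace ℝ (Fin n)) (p : EuclideanSpace ℝ (Fin n) → ℝ)
    (lam : Fin N → ℝ) (u v : ℝ) (y : EuclideanSpace ℝ (Fin n)) : ℝ :=
  p y * Real.exp (-1 - v * phi d x lam y - u)

/-- The two-variable objective `-u - v δ - ∫_K p e^{-(1 + v φ_lam + u)}`. -/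
def dualObjective {n N : ℕ} (K : Set (EuclideanSpace ℝ (Fin n)))
    (d : EuclideanSpace ℝ (Fin n) → EuclideanSpace ℝ (Fin n) → ℝ)
    (x : Fin N → EuclideanSpace ℝ (Fin n)) (p : EuclideanSpace ℝ (Fin n) → ℝ) (δ : ℝ)
    (lam : Fin N → ℝ) (w : ℝ × ℝ) : ℝ :=
  -w.1 - w.2 * δ - ∫ y in K, p y * Real.exp (-(1 + w.2 * phi d x lam y + w.1))

/-- `(u, v)` maximizes the two-variable objective over `v ≥ 0`. -/
def IsDualMaximizer {n N : ℕ} (K : Set (EuclideanSpace ℝ (Fin n)))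
    (d : EuclideanSpace ℝ (Fin n) → EuclideanSpace ℝ (Fin n) → ℝ)
    (x : Fin N → EuclideanSpace ℝ (Fin n)) (p : EuclideanSpace ℝ (Fin n) → ℝ) (δ : ℝ)
    (lam : Fin N → ℝ) (u v : ℝ) : Prop :=
  0 ≤ v ∧ ∀ u' v' : ℝ, 0 ≤ v' →
    dualObjective K d x p δ lam (u', v') ≤ dualObjective K d x p δ lam (u, v)

/-- The weighted Voronoi region `R_i(lam)`. -/
def voronoiRegion {n N : ℕ} (K : Set (EuclideanSpace ℝ (Fin n)))
    (d : EuclideanSpace ℝ (Fin n) → EuclideanSpace ℝ (Fin n) → ℝ)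
    (x : Fin N → EuclideanSpace ℝ (Fin n)) (lam : Fin N → ℝ) (i : Fin N) :
    Set (EuclideanSpace ℝ (Fin n)) :=
  {y ∈ K | ∀ j, d y (x i) - lam i ≤ d y (x j) - lam j}

/-- The vector `g` with `gᵢ = 1/N - ∫_{R_i(lam)} q̄`. -/
def cutVector {n N : ℕ} (K : Set (EuclideanSpace ℝ (Fin n)))
    (d : EuclideanSpace ℝ (Fin n) → EuclideanSpace ℝ (Fin n) → ℝ)
    (x : Fin N → EuclideanSpace ℝ (Fin n)) (p : EuclideanSpace ℝ (Fin n) → ℝ)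
    (lam : Fin N → ℝ) (u v : ℝ) (i : Fin N) : ℝ :=
  1 / (N : ℝ) - ∫ y in voronoiRegion K d x lam i, expDensity d x p lam u v y

/-- The set of maximizers of `Γ` on `Λ`. -/
def gamMaximizers {n N : ℕ} (K : Set (EuclideanSpace ℝ (Fin n)))
    (d : EuclideanSpace ℝ (Fin n) → EuclideanSpace ℝ (Fin n) → ℝ)
    (x : Fin N → EuclideanSpace ℝ (Fin n)) (p : EuclideanSpace ℝ (Fin n) → ℝ) (δ : ℝ) :
    Set (Fin N → ℝ) :=
  {lam ∈ weightSpace N | ∀ lam' ∈ weightSpace N, Gam K d x p δ lam' ≤ Gam K d x p δ lam}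

/-- `q` is the unique (up to a.e. equality on `K`) density of minimum cross-entropy with respect
to `p` in the Wasserstein ball. -/
def IsUniqueMinEntropyDensity {n N : ℕ} (K : Set (EuclideanSpace ℝ (Fin n)))
    (d : EuclideanSpace ℝ (Fin n) → EuclideanSpace ℝ (Fin n) → ℝ)
    (x : Fin N → EuclideanSpace ℝ (Fin n)) (p : EuclideanSpace ℝ (Fin n) → ℝ) (δ : ℝ)
    (q : EuclideanSpace ℝ (Fin n) → ℝ) : Prop :=
  q ∈ wassersteinBall K d x δ ∧
    (∀ q' ∈ wassersteinBall K d x δ, crossEntropy K q p ≤ crossEntropy K q' p) ∧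
    ∀ q' ∈ wassersteinBall K d x δ, crossEntropy K q' p = crossEntropy K q p →
      q' =ᵐ[volume.restrict K] q

/-- `(lam, u, v)`, with `lam ∈ Λ`, parametrizes the unique density of minimum cross-entropy in
the Wasserstein ball as `p exp(-1 - v φ_lam - u)`. -/
def IsOptimalParameter {n N : ℕ} (K : Set (EuclideanSpace ℝ (Fin n)))
    (d : EuclideanSpace ℝ (Fin n) → EuclideanSpace ℝ (Fin n) → ℝ)
    (x : Fin N → EuclideanSpace ℝ (Fin n)) (p : EuclideanSpace ℝ (Fin n) → ℝ) (δ : ℝ)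
    (lam : Fin N → ℝ) (u v : ℝ) : Prop :=
  lam ∈ weightSpace N ∧ IsUniqueMinEntropyDensity K d x p δ (expDensity d x p lam u v)

end

end MinCrossEntropy

open MinCrossEntropy

/-!
Write `ψ_{(v, w)}(y) = minᵢ (v d(y, xᵢ) - wᵢ)`. For `v ≥ 0` one has `v φ_λ + u = ψ_{(v, v λ - u)}`, so
the dual objectives of all the problems `Γ(λ)` are restrictions of a single concave function
`F(v, w) = (1/N) ∑ wᵢ - v δ - ∫_K p exp(-1 - ψ_{(v, w)})` on `ℝ × ℝᴺ`. It is continuous, being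
concave and finite, and its superlevel sets in `{v ≥ 0}` are bounded because `p` charges the balls of
radius `δ/2` around the sites (`Setting.exists_bound_of_le_jointDual`); hence all dual problems, and
`F` itself, have maximizers. The first-order conditions at a maximizer come from the bound
`exp(-s) ≤ 1 - s + s²` (`integral_mul_le_of_forall_integral_exp`).

For a fixed `λ` these conditions say that the exponential density of a dual maximizer is feasible and
satisfies complementary slackness. Together with Gibbs' inequality this gives strong duality, and the
equality case of Gibbs' inequality gives uniqueness of the minimizer. The cutting plane follows from
weak duality: if `⟨g, λ' - λ⟩ < 0`, the minimizer for `λ` satisfies the constraint of `λ'` strictly,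
and the multiplier of that constraint is positive.

Semi-discrete Kantorovich duality identifies the Wasserstein ball with `⋂_λ Ω(λ)`
(`Setting.mem_wassersteinBall_iff`): a maximizer of `λ ↦ ∫ φ_λ q` has Voronoi regions of mass `1/N`,
and then sending each region to its site is an optimal plan. At a maximizer of `F` the first-order
conditions put the exponential density in every `Ω(λ')`, hence in the ball, and make it optimal there
(`Setting.IsJointMaximizer.isOptimalParameter`). Finally `v > 0` when `𝒲(p, μ) > δ`, all Voronoi
regions at the optimum have positive mass, and then `v φ_λ + u` determines `(λ, u, v)`
(`Setting.parameters_eq`); this yields uniqueness of the triple and of the maximizer of `Γ`.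
-/

namespace MinCrossEntropy

/-! ### The weighted minimum of distances -/

/-- The function `ψ_{(v, w)}(y) = minᵢ (v d(y, xᵢ) - wᵢ)`, for `θ = (v, w)`. It is jointly concave
and positively homogeneous in `θ`, and `φ_λ = ψ_{(1, λ)}`. -/
noncomputable def psi {n N : ℕ} (d : EuclideanSpace ℝ (Fin n) → EuclideanSpace ℝ (Fin n) → ℝ)
    (x : Fin N → EuclideanSpace ℝ (Fin n)) (θ : ℝ × (Fin N → ℝ))
    (y : EuclideanSpace ℝ (Fin n)) : ℝ :=
  ⨅ i, (θ.1 * d y (x i) - θ.2 i)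

section Psi

variable {n N : ℕ} {K : Set (EuclideanSpace ℝ (Fin n))}
  {d : EuclideanSpace ℝ (Fin n) → EuclideanSpace ℝ (Fin n) → ℝ}
  {x : Fin N → EuclideanSpace ℝ (Fin n)}

lemma psi_le (θ : ℝ × (Fin N → ℝ)) (y : EuclideanSpace ℝ (Fin n)) (i : Fin N) :
    psi d x θ y ≤ θ.1 * d y (x i) - θ.2 i :=
  ciInf_le (Set.finite_range _).bddBelow i

lemma phi_eq_psi (lam : Fin N → ℝ) (y : EuclideanSpace ℝ (Fin n)) :
    phi d x lam y = psi d x (1, lam) y := by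
  simp [phi, psi]

lemma phi_le (lam : Fin N → ℝ) (y : EuclideanSpace ℝ (Fin n)) (i : Fin N) :
    phi d x lam y ≤ d y (x i) - lam i :=
  ciInf_le (Set.finite_range _).bddBelow i

variable [Nonempty (Fin N)]

lemma le_psi {θ : ℝ × (Fin N → ℝ)} {y : EuclideanSpace ℝ (Fin n)} {c : ℝ}
    (h : ∀ i, c ≤ θ.1 * d y (x i) - θ.2 i) : c ≤ psi d x θ y :=
  le_ciInf h

lemma le_phi {lam : Fin N → ℝ} {y : EuclideanSpace ℝ (Fin n)} {c : ℝ}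
    (h : ∀ i, c ≤ d y (x i) - lam i) : c ≤ phi d x lam y :=
  le_ciInf h

lemma exists_phi_eq (d : EuclideanSpace ℝ (Fin n) → EuclideanSpace ℝ (Fin n) → ℝ)
    (x : Fin N → EuclideanSpace ℝ (Fin n)) (lam : Fin N → ℝ) (y : EuclideanSpace ℝ (Fin n)) :
    ∃ i, phi d x lam y = d y (x i) - lam i := by
  obtain ⟨i, hi⟩ := exists_eq_ciInf_of_finite (f := fun i => d y (x i) - lam i)
  exact ⟨i, hi.symm⟩

lemma psi_add_le (θ η : ℝ × (Fin N → ℝ)) (y : EuclideanSpace ℝ (Fin n)) :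
    psi d x θ y + psi d x η y ≤ psi d x (θ + η) y := by
  refine le_psi fun i => ?_
  have h1 := psi_le (d := d) (x := x) θ y i
  have h2 := psi_le (d := d) (x := x) η y i
  simp only [Prod.fst_add, Prod.snd_add, Pi.add_apply]
  linarith

omit [Nonempty (Fin N)] in
lemma psi_smul {t : ℝ} (ht : 0 ≤ t) (θ : ℝ × (Fin N → ℝ)) (y : EuclideanSpace ℝ (Fin n)) :
    psi d x (t • θ) y = t * psi d x θ y := by
  simp only [psi, Real.mul_iInf_of_nonneg ht, Prod.smul_fst, Prod.smul_snd, Pi.smul_apply,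
    smul_eq_mul]
  congr 1; ext i; ring

lemma psi_sub_const (v : ℝ) (w : Fin N → ℝ) (u : ℝ) (y : EuclideanSpace ℝ (Fin n)) :
    psi d x (v, fun i => w i - u) y = psi d x (v, w) y + u := by
  apply le_antisymm
  · rw [← sub_le_iff_le_add]
    refine le_psi fun i => ?_
    have := psi_le (d := d) (x := x) (v, fun i => w i - u) y i
    simp only at this ⊢
    linarith
  · refine le_psi fun i => ?_
    have := psi_le (d := d) (x := x) (v, w) y i
    simp only at this ⊢
    linarith

lemma psi_eq_mul_phi_add {v : ℝ} (hv : 0 ≤ v) (u : ℝ) (lam : Fin N → ℝ)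
    (y : EuclideanSpace ℝ (Fin n)) :
    psi d x (v, fun i => v * lam i - u) y = v * phi d x lam y + u := by
  rw [psi_sub_const v (fun i => v * lam i), phi_eq_psi, ← psi_smul hv]
  congr 2
  simp [Prod.ext_iff]
  rfl

omit [Nonempty (Fin N)] in
lemma continuousOn_psi (hd : ∀ i, ContinuousOn (fun y => d y (x i)) K) (θ : ℝ × (Fin N → ℝ)) :
    ContinuousOn (psi d x θ) K := by
  rcases isEmpty_or_nonempty (Fin N) with h | h
  · exact (continuousOn_const (c := (0:ℝ))).congr fun y _ => by simp [psi]
  · have : psi d x θ = fun y =>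
        Finset.univ.inf' Finset.univ_nonempty fun i => (θ.1 * d y (x i) - θ.2 i) := by
      ext y; rw [psi, Finset.inf'_univ_eq_ciInf]
    rw [this]
    exact ContinuousOn.finset_inf'_apply _ fun i _ =>
      (continuousOn_const.mul (hd i)).sub continuousOn_const

omit [Nonempty (Fin N)] in
lemma continuousOn_phi (hd : ∀ i, ContinuousOn (fun y => d y (x i)) K) (lam : Fin N → ℝ) :
    ContinuousOn (phi d x lam) K :=
  (continuousOn_psi hd (1, lam)).congr fun y _ => phi_eq_psi lam y

end Psi

/-! ### The standing assumptions -/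

/-- The data of the problem: a regular compact set `K`, a continuous metric `d` on it, points `xᵢ`
of `K` whose hyperbola-like loci are null, and a continuous positive density `p`. -/
structure Setting {n N : ℕ} (K : Set (EuclideanSpace ℝ (Fin n)))
    (d : EuclideanSpace ℝ (Fin n) → EuclideanSpace ℝ (Fin n) → ℝ)
    (x : Fin N → EuclideanSpace ℝ (Fin n)) (p : EuclideanSpace ℝ (Fin n) → ℝ) : Prop where
  pos : 0 < N
  regular : IsRegularCompact K
  metric : IsContinuousMetricOn K d
  mem : ∀ i, x i ∈ K
  null : ∀ i j, i ≠ j → ∀ t : ℝ, volume {y ∈ K | d y (x i) - d y (x j) = t} = 0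
  cont : ContinuousOn p K
  ppos : ∀ y ∈ K, 0 < p y
  pint : ∫ y in K, p y = 1

namespace Setting

variable {n N : ℕ} {K : Set (EuclideanSpace ℝ (Fin n))}
  {d : EuclideanSpace ℝ (Fin n) → EuclideanSpace ℝ (Fin n) → ℝ}
  {x : Fin N → EuclideanSpace ℝ (Fin n)} {p : EuclideanSpace ℝ (Fin n) → ℝ}

lemma nonempty (S : Setting K d x p) : Nonempty (Fin N) := ⟨⟨0, S.pos⟩⟩

lemma isCompact (S : Setting K d x p) : IsCompact K := by
  obtain ⟨U, -, hU, rfl⟩ := S.regular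
  exact hU.isCompact_closure

lemma measurableSet (S : Setting K d x p) : MeasurableSet K := S.isCompact.measurableSet

lemma continuousOn_dist (S : Setting K d x p) (i : Fin N) :
    ContinuousOn (fun y => d y (x i)) K :=
  S.metric.continuousOn.comp (f := fun y => (y, x i)) (by fun_prop) fun _ hy => ⟨hy, S.mem i⟩

lemma dist_self (S : Setting K d x p) (i : Fin N) : d (x i) (x i) = 0 :=
  (S.metric.eq_zero_iff _ (S.mem i) _ (S.mem i)).2 rfl

lemma dist_nonneg (S : Setting K d x p) {y z : EuclideanSpace ℝ (Fin n)} (hy : y ∈ K)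
    (hz : z ∈ K) : 0 ≤ d y z := by
  have h1 := S.metric.triangle y hy z hz y hy
  rw [(S.metric.eq_zero_iff y hy y hy).2 rfl, S.metric.symm z hz y hy] at h1
  linarith

lemma psi_continuousOn (S : Setting K d x p) (θ : ℝ × (Fin N → ℝ)) :
    ContinuousOn (psi d x θ) K := continuousOn_psi S.continuousOn_dist θ

lemma phi_continuousOn (S : Setting K d x p) (lam : Fin N → ℝ) :
    ContinuousOn (phi d x lam) K := continuousOn_phi S.continuousOn_dist lam

lemma integrableOn_p (S : Setting K d x p) : IntegrableOn p K :=
  S.cont.integrableOn_compact S.isCompact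

lemma integrableOn_mul (S : Setting K d x p) {g q : EuclideanSpace ℝ (Fin n) → ℝ}
    (hg : ContinuousOn g K) (hq : IntegrableOn q K) : IntegrableOn (fun y => g y * q y) K :=
  hq.continuousOn_mul hg S.isCompact

/-- A nonempty relatively open subset of `K` has positive volume. -/
lemma volume_pos (S : Setting K d x p) {V : Set (EuclideanSpace ℝ (Fin n))} (hV : IsOpen V)
    {z : EuclideanSpace ℝ (Fin n)} (hzV : z ∈ V) (hzK : z ∈ K) : 0 < volume (V ∩ K) := by
  obtain ⟨U, hU, -, rfl⟩ := S.regular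
  have hne : (V ∩ U).Nonempty := mem_closure_iff.1 hzK V hV hzV
  exact ((hV.inter hU).measure_pos volume hne).trans_le
    (measure_mono (Set.inter_subset_inter_right _ subset_closure))

/-- Continuous functions on `K` that agree a.e. agree everywhere on `K`. -/
lemma eqOn_of_ae_eq (S : Setting K d x p) {f g : EuclideanSpace ℝ (Fin n) → ℝ}
    (hf : ContinuousOn f K) (hg : ContinuousOn g K) (h : f =ᵐ[volume.restrict K] g) :
    Set.EqOn f g K := by
  by_contra hne
  simp only [Set.EqOn, not_forall] at hne
  obtain ⟨z, hzK, hz⟩ := hne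
  obtain ⟨V, hV, hVK⟩ := (continuousOn_iff'.1 (hf.sub hg)) {0}ᶜ isOpen_compl_singleton
  have hzV : z ∈ V := (hVK ▸ ⟨by simpa [sub_eq_zero] using hz, hzK⟩ : z ∈ V ∩ K).1
  refine (S.volume_pos hV hzV hzK).ne' ?_
  rw [Filter.EventuallyEq, ae_restrict_iff' S.measurableSet, ae_iff] at h
  refine measure_mono_null ?_ h
  rw [← hVK]
  rintro y ⟨hy, hyK⟩
  simp only [Set.mem_preimage, Set.mem_compl_iff, Set.mem_singleton_iff] at hy
  simpa using ⟨hyK, fun h => hy (sub_eq_zero.2 h)⟩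

/-- The loci `d(·, xᵢ) - d(·, xⱼ) = t` contain almost no point of `K`. -/
lemma ae_ne (S : Setting K d x p) {i j : Fin N} (hij : i ≠ j) (t : ℝ) :
    ∀ᵐ y ∂(volume.restrict K), d y (x i) - d y (x j) ≠ t := by
  rw [ae_restrict_iff' S.measurableSet, ae_iff]
  simpa using S.null i j hij t

lemma injective (S : Setting K d x p) : Function.Injective x := by
  intro i j h
  by_contra hij
  have h1 : ∀ᵐ y ∂(volume.restrict K), False := by
    filter_upwards [S.ae_ne hij 0] with y hy
    exact hy (by rw [h, sub_self])
  have h2 : volume (Set.univ ∩ K) = 0 := by simpa [ae_iff] using h1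
  exact (S.volume_pos isOpen_univ trivial (S.mem i)).ne' h2

end Setting

/-! ### The joint dual problem -/

/-- The density `p exp(-1 - ψ_θ)`, the minimizer of the Lagrangian for the multipliers `θ`. -/
noncomputable def gibbs {n N : ℕ} (d : EuclideanSpace ℝ (Fin n) → EuclideanSpace ℝ (Fin n) → ℝ)
    (x : Fin N → EuclideanSpace ℝ (Fin n)) (p : EuclideanSpace ℝ (Fin n) → ℝ)
    (θ : ℝ × (Fin N → ℝ)) (y : EuclideanSpace ℝ (Fin n)) : ℝ :=
  p y * Real.exp (-(1 + psi d x θ y))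

/-- The joint dual function `F(v, w) = (1/N) ∑ wᵢ - v δ - ∫_K p exp(-1 - ψ_{(v, w)})`. The change of
variables `w = v λ - u` makes all the dual problems of the `Γ(λ)` restrictions of this single
concave function, without a constraint on `w`. -/
noncomputable def jointDual {n N : ℕ} (K : Set (EuclideanSpace ℝ (Fin n)))
    (d : EuclideanSpace ℝ (Fin n) → EuclideanSpace ℝ (Fin n) → ℝ)
    (x : Fin N → EuclideanSpace ℝ (Fin n)) (p : EuclideanSpace ℝ (Fin n) → ℝ) (δ : ℝ)
    (θ : ℝ × (Fin N → ℝ)) : ℝ :=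
  (∑ i, θ.2 i) / N - θ.1 * δ - ∫ y in K, gibbs d x p θ y

/-- A continuous function on a closed set with a bounded nonempty superlevel set has a maximum. -/
lemma exists_forall_le_of_bounded_superlevel {V : Type*} [NormedAddCommGroup V] [ProperSpace V]
    {f : V → ℝ} (hf : Continuous f) {C : Set V} (hC : IsClosed C) {a : V} (ha : a ∈ C) (R : ℝ)
    (hR : ∀ b ∈ C, f a ≤ f b → ‖b‖ ≤ R) : ∃ b ∈ C, ∀ c ∈ C, f c ≤ f b := by
  have hcpt : IsCompact (C ∩ Metric.closedBall 0 R) :=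
    (isCompact_closedBall (0 : V) R).inter_left hC
  have haR : a ∈ C ∩ Metric.closedBall 0 R := ⟨ha, by simpa using hR a ha le_rfl⟩
  obtain ⟨b, hb, hmax⟩ := hcpt.exists_isMaxOn ⟨a, haR⟩ hf.continuousOn
  refine ⟨b, hb.1, fun c hc => ?_⟩
  by_cases hac : f a ≤ f c
  · exact hmax ⟨hc, by simpa using hR c hc hac⟩
  · exact (not_le.1 hac).le.trans (hmax haR)

/-- First-order condition for functionals of the form `t ↦ ∫ q exp(-t g)`. -/
lemma integral_mul_le_of_forall_integral_exp {n : ℕ} {K : Set (EuclideanSpace ℝ (Fin n))}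
    (hK : IsCompact K) {q g : EuclideanSpace ℝ (Fin n) → ℝ} (hq : IntegrableOn q K)
    (hq0 : ∀ y ∈ K, 0 ≤ q y) (hg : ContinuousOn g K) {c : ℝ}
    (h : ∀ t : ℝ, 0 < t → t ≤ 1 →
      (∫ y in K, q y) - t * c ≤ ∫ y in K, q y * Real.exp (-(t * g y))) :
    ∫ y in K, g y * q y ≤ c := by
  obtain ⟨B, hB⟩ := hK.exists_bound_of_continuousOn hg
  have hB' : ∀ y ∈ K, |g y| ≤ |B| + 1 := fun y hy =>
    (hB y hy).trans ((le_abs_self B).trans (by linarith))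
  set b := |B| + 1 with hb
  have hbpos : 1 ≤ b := by have := abs_nonneg B; linarith
  have hgq : IntegrableOn (fun y => g y * q y) K := hq.continuousOn_mul hg hK
  have key : ∀ t : ℝ, 0 < t → t ≤ 1 / b →
      ∫ y in K, g y * q y ≤ c + t * (b ^ 2 * ∫ y in K, q y) := by
    intro t ht htb
    have ht1 : t ≤ 1 := htb.trans (by rw [div_le_one (by linarith)]; exact hbpos)
    have hint : IntegrableOn (fun y => q y * Real.exp (-(t * g y))) K :=
      hq.mul_continuousOn ((continuousOn_const.mul hg).neg.rexp) hK
    have h1 : ∫ y in K, q y * Real.exp (-(t * g y)) ≤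
        ∫ y in K, ((q y - t * (g y * q y)) + t ^ 2 * b ^ 2 * q y) := by
      refine setIntegral_mono_on hint ((hq.sub (hgq.const_mul t)).add (hq.const_mul _))
        hK.measurableSet fun y hy => ?_
      have hy1 : |-(t * g y)| ≤ 1 := by
        rw [abs_neg, abs_mul, abs_of_pos ht]
        calc t * |g y| ≤ 1 / b * b := by gcongr; exact hB' y hy
          _ = 1 := by field_simp
      have h2 := (abs_le.1 (Real.abs_exp_sub_one_sub_id_le hy1)).2
      have h3 : (-(t * g y)) ^ 2 ≤ t ^ 2 * b ^ 2 := by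
        rw [neg_sq, mul_pow]
        refine mul_le_mul_of_nonneg_left ?_ (sq_nonneg t)
        exact sq_le_sq' (by linarith [(abs_le.1 (hB' y hy)).1]) (abs_le.1 (hB' y hy)).2
      have h4 : Real.exp (-(t * g y)) ≤ 1 - t * g y + t ^ 2 * b ^ 2 := by linarith
      have := mul_le_mul_of_nonneg_left h4 (hq0 y hy)
      linarith
    rw [integral_add (f := fun y => q y - t * (g y * q y)) (hq.sub (hgq.const_mul t))
      (hq.const_mul _), integral_sub hq (hgq.const_mul t), integral_const_mul,
      integral_const_mul] at h1
    have h2 := h t ht ht1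
    have h3 : t * ∫ y in K, g y * q y ≤ t * (c + t * (b ^ 2 * ∫ y in K, q y)) := by
      nlinarith
    exact le_of_mul_le_mul_left h3 ht
  have hlim : Filter.Tendsto (fun t : ℝ => c + t * (b ^ 2 * ∫ y in K, q y))
      (nhdsWithin 0 (Set.Ioi 0)) (nhds (c + 0 * (b ^ 2 * ∫ y in K, q y))) := by
    apply Filter.Tendsto.mono_left _ nhdsWithin_le_nhds
    exact (Continuous.tendsto (by fun_prop) 0)
  rw [zero_mul, add_zero] at hlim
  refine ge_of_tendsto hlim ?_
  filter_upwards [Ioc_mem_nhdsGT (show (0 : ℝ) < 1 / b by positivity)] with t ht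
  exact key t ht.1 ht.2

/-- A growth estimate behind the coercivity of the dual: `s - c eˢ` is bounded above by an affine
function of slope `-1`, by the tangent line of the exponential. -/
lemma exists_two_mul_sub_le_mul_exp {c : ℝ} (hc : 0 < c) :
    ∃ B : ℝ, ∀ s : ℝ, 2 * s - B ≤ c * Real.exp s := by
  refine ⟨-2 * (Real.log c - Real.log 2 + 1), fun s => ?_⟩
  have h := Real.add_one_le_exp (s + Real.log c - Real.log 2)
  rw [Real.exp_sub, Real.exp_add, Real.exp_log hc, Real.exp_log two_pos] at h
  linarith

namespace Setting

variable {n N : ℕ} {K : Set (EuclideanSpace ℝ (Fin n))}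
  {d : EuclideanSpace ℝ (Fin n) → EuclideanSpace ℝ (Fin n) → ℝ}
  {x : Fin N → EuclideanSpace ℝ (Fin n)} {p : EuclideanSpace ℝ (Fin n) → ℝ}

lemma gibbs_continuousOn (S : Setting K d x p) (θ : ℝ × (Fin N → ℝ)) :
    ContinuousOn (gibbs d x p θ) K :=
  S.cont.mul (continuousOn_const.add (S.psi_continuousOn θ)).neg.rexp

lemma gibbs_integrableOn (S : Setting K d x p) (θ : ℝ × (Fin N → ℝ)) :
    IntegrableOn (gibbs d x p θ) K :=
  (S.gibbs_continuousOn θ).integrableOn_compact S.isCompact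

lemma gibbs_pos (S : Setting K d x p) (θ : ℝ × (Fin N → ℝ)) {y : EuclideanSpace ℝ (Fin n)}
    (hy : y ∈ K) : 0 < gibbs d x p θ y :=
  mul_pos (S.ppos y hy) (Real.exp_pos _)

lemma expDensity_eq_gibbs (S : Setting K d x p) (lam : Fin N → ℝ) (u : ℝ) {v : ℝ} (hv : 0 ≤ v) :
    expDensity d x p lam u v = gibbs d x p (v, fun i => v * lam i - u) := by
  have := S.nonempty
  ext y
  rw [expDensity, gibbs, psi_eq_mul_phi_add hv]
  congr 2; ring

lemma expDensity_continuousOn (S : Setting K d x p) (lam : Fin N → ℝ) (u v : ℝ) :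
    ContinuousOn (expDensity d x p lam u v) K :=
  S.cont.mul (((continuousOn_const.sub (continuousOn_const.mul
    (S.phi_continuousOn lam))).sub continuousOn_const).rexp)

lemma expDensity_integrableOn (S : Setting K d x p) (lam : Fin N → ℝ) (u v : ℝ) :
    IntegrableOn (expDensity d x p lam u v) K :=
  (S.expDensity_continuousOn lam u v).integrableOn_compact S.isCompact

lemma expDensity_pos (S : Setting K d x p) (lam : Fin N → ℝ) (u v : ℝ)
    {y : EuclideanSpace ℝ (Fin n)} (hy : y ∈ K) : 0 < expDensity d x p lam u v y :=
  mul_pos (S.ppos y hy) (Real.exp_pos _)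

lemma dualObjective_eq_jointDual (S : Setting K d x p) (δ : ℝ) {lam : Fin N → ℝ}
    (hlam : lam ∈ weightSpace N) (u : ℝ) {v : ℝ} (hv : 0 ≤ v) :
    dualObjective K d x p δ lam (u, v) = jointDual K d x p δ (v, fun i => v * lam i - u) := by
  have hN : (N : ℝ) ≠ 0 := by exact_mod_cast S.pos.ne'
  have hsum : ∑ i, lam i = 0 := hlam
  rw [jointDual, ← S.expDensity_eq_gibbs lam u hv]
  have h1 : (∑ i, (v * lam i - u)) / N = -u := by
    rw [Finset.sum_sub_distrib, ← Finset.mul_sum, hsum]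
    simp
    field_simp
  simp only [h1, dualObjective, expDensity]
  congr 1
  refine integral_congr_ae (Filter.Eventually.of_forall fun y => ?_)
  simp only
  congr 2; ring

lemma concaveOn_jointDual (S : Setting K d x p) (δ : ℝ) :
    ConcaveOn ℝ Set.univ (jointDual K d x p δ) := by
  have := S.nonempty
  refine ⟨convex_univ, fun θ _ η _ a b ha hb hab => ?_⟩
  have hint : ∫ y in K, gibbs d x p (a • θ + b • η) y ≤
      ∫ y in K, (a * gibbs d x p θ y + b * gibbs d x p η y) := by
    refine setIntegral_mono_on (S.gibbs_integrableOn _)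
      (((S.gibbs_integrableOn θ).const_mul a).add ((S.gibbs_integrableOn η).const_mul b))
      S.measurableSet fun y hy => ?_
    have h1 := psi_add_le (d := d) (x := x) (a • θ) (b • η) y
    rw [psi_smul ha, psi_smul hb] at h1
    have h2 := convexOn_exp.2 (Set.mem_univ (-(1 + psi d x θ y)))
      (Set.mem_univ (-(1 + psi d x η y))) ha hb hab
    simp only [smul_eq_mul] at h2
    have h3 : Real.exp (-(1 + psi d x (a • θ + b • η) y)) ≤
        Real.exp (a * -(1 + psi d x θ y) + b * -(1 + psi d x η y)) := by
      apply Real.exp_le_exp.2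
      linear_combination h1 + hab
    have := mul_le_mul_of_nonneg_left (h3.trans h2) (S.ppos y hy).le
    simp only [gibbs]
    linarith
  rw [integral_add ((S.gibbs_integrableOn θ).const_mul a) ((S.gibbs_integrableOn η).const_mul b),
    integral_const_mul, integral_const_mul] at hint
  have hs : (∑ i, (a • θ + b • η).2 i) / (N : ℝ) =
      a * ((∑ i, θ.2 i) / N) + b * ((∑ i, η.2 i) / N) := by
    simp [Finset.sum_add_distrib, ← Finset.mul_sum]
    ring
  simp only [jointDual, hs, smul_eq_mul]
  simp only [Prod.fst_add, Prod.smul_fst, smul_eq_mul]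
  linarith

lemma continuous_jointDual (S : Setting K d x p) (δ : ℝ) :
    Continuous (jointDual K d x p δ) := by
  rw [← continuousOn_univ]
  exact (S.concaveOn_jointDual δ).continuousOn isOpen_univ

/-- The balls of radius `r` around the sites carry positive mass, uniformly in the site. This makes
the exponential term of the dual large when `v` or some `wᵢ` is large. -/
lemma exists_mul_exp_le_integral_gibbs (S : Setting K d x p) {r : ℝ} (hr : 0 < r) :
    ∃ c : ℝ, 0 < c ∧ ∀ v : ℝ, 0 ≤ v → ∀ (w : Fin N → ℝ) (i : Fin N),
      c * Real.exp (w i - v * r) ≤ ∫ y in K, gibbs d x p (v, w) y := by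
  have := S.nonempty
  have hloc : ∀ i : Fin N, ∃ c : ℝ, 0 < c ∧ ∀ v : ℝ, 0 ≤ v → ∀ (w : Fin N → ℝ),
      c * Real.exp (w i - v * r) ≤ ∫ y in K, gibbs d x p (v, w) y := by
    intro i
    obtain ⟨V, hV, hVK⟩ := (continuousOn_iff'.1 (S.continuousOn_dist i)) (Set.Iio r) isOpen_Iio
    have hxV : x i ∈ V :=
      (hVK ▸ ⟨by simpa [S.dist_self] using hr, S.mem i⟩ : x i ∈ V ∩ K).1
    have hmeas : MeasurableSet (V ∩ K) := hV.measurableSet.inter S.measurableSet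
    have hpV : IntegrableOn p (V ∩ K) := S.integrableOn_p.mono_set Set.inter_subset_right
    refine ⟨(∫ y in V ∩ K, p y) * Real.exp (-1), mul_pos ?_ (Real.exp_pos _), fun v hv w => ?_⟩
    · rw [setIntegral_pos_iff_support_of_nonneg_ae _ hpV]
      · have : Function.support p ∩ (V ∩ K) = V ∩ K :=
          Set.inter_eq_right.2 fun y hy => (S.ppos y hy.2).ne'
        rw [this]
        exact S.volume_pos hV hxV (S.mem i)
      · filter_upwards [ae_restrict_mem hmeas] with y hy using (S.ppos y hy.2).le
    · rw [mul_assoc, ← Real.exp_add, ← integral_mul_const]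
      calc ∫ y in V ∩ K, p y * Real.exp (-1 + (w i - v * r))
          ≤ ∫ y in V ∩ K, gibbs d x p (v, w) y := by
            refine setIntegral_mono_on (hpV.mul_const _)
              ((S.gibbs_integrableOn _).mono_set Set.inter_subset_right) hmeas fun y hy => ?_
            have h1 : d y (x i) < r := (hVK.symm.subset hy).1
            have h2 := psi_le (d := d) (x := x) (v, w) y i
            have h3 := mul_le_mul_of_nonneg_left h1.le hv
            refine mul_le_mul_of_nonneg_left (Real.exp_le_exp.2 ?_) (S.ppos y hy.2).le
            simp only at h2
            linarith
        _ ≤ ∫ y in K, gibbs d x p (v, w) y := by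
            refine setIntegral_mono_set (S.gibbs_integrableOn _) ?_
              (Filter.Eventually.of_forall Set.inter_subset_right)
            filter_upwards [ae_restrict_mem S.measurableSet] with y hy using (S.gibbs_pos _ hy).le
  choose c hc hle using hloc
  refine ⟨Finset.univ.inf' Finset.univ_nonempty c, ?_, fun v hv w i => ?_⟩
  · rw [Finset.lt_inf'_iff]; exact fun i _ => hc i
  · refine le_trans ?_ (hle i v hv w)
    gcongr
    exact Finset.inf'_le _ (Finset.mem_univ i)

/-- The superlevel sets of the joint dual function on `{v ≥ 0}` are bounded. -/
lemma exists_bound_of_le_jointDual (S : Setting K d x p) {δ : ℝ} (hδ : 0 < δ) (a : ℝ) :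
    ∃ R : ℝ, ∀ θ : ℝ × (Fin N → ℝ), 0 ≤ θ.1 → a ≤ jointDual K d x p δ θ → ‖θ‖ ≤ R := by
  have := S.nonempty
  have hN : (0 : ℝ) < N := by exact_mod_cast S.pos
  obtain ⟨c, hc, hle⟩ := S.exists_mul_exp_le_integral_gibbs (half_pos hδ)
  obtain ⟨B, hB⟩ := exists_two_mul_sub_le_mul_exp hc
  -- With `M = max wᵢ = w i`, `m` the mean of `w` and `s = M - v δ / 2`, the dual value is at most
  -- `(m - M) - v δ / 2 + (s - c eˢ)`, and `s - c eˢ ≤ min (s, B - s) ≤ B / 2`.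
  set T := B / 2 - a with hT
  refine ⟨2 * T / δ + (|a| + N * T + |B - a| + T), fun ⟨v, w⟩ hv ha => ?_⟩
  simp only at hv
  obtain ⟨i, hi⟩ := Finite.exists_max w
  set m := (∑ j, w j) / N with hm
  have hmM : m ≤ w i := by
    rw [hm, div_le_iff₀ hN]
    calc ∑ j, w j ≤ ∑ _j : Fin N, w i := Finset.sum_le_sum fun j _ => hi j
      _ = w i * N := by simp [mul_comm]
  have hF : a ≤ m - v * δ - c * Real.exp (w i - v * (δ / 2)) := by
    have := hle v hv w i
    simp only [jointDual] at ha
    linarith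
  have h1 := hB (w i - v * (δ / 2))
  have h2 : 0 < c * Real.exp (w i - v * (δ / 2)) := mul_pos hc (Real.exp_pos _)
  have hvd : 0 ≤ v * δ := mul_nonneg hv hδ.le
  have hvT : v * δ ≤ 2 * T := by linarith
  have hMT : w i - m ≤ T := by linarith
  have hT0 : 0 ≤ T := by linarith
  have hvle : v ≤ 2 * T / δ := by rwa [le_div_iff₀ hδ]
  have hNT : 0 ≤ N * T := mul_nonneg hN.le hT0
  have hdiv : 0 ≤ 2 * T / δ := hv.trans hvle
  have ha1 := neg_abs_le a
  have ha2 := le_abs_self (B - a)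
  have ha3 := abs_nonneg a
  have ha4 := abs_nonneg (B - a)
  rw [Prod.norm_def]
  refine max_le ?_ ?_
  · rw [Real.norm_of_nonneg hv]; linarith
  · rw [pi_norm_le_iff_of_nonneg (by linarith)]
    intro j
    have hj : w i - w j ≤ N * (w i - m) := by
      have h3 := Finset.single_le_sum (f := fun k => w i - w k)
        (fun k _ => sub_nonneg.2 (hi k)) (Finset.mem_univ j)
      have h4 : ∑ k, (w i - w k) = N * (w i - m) := by
        rw [Finset.sum_sub_distrib, hm]
        simp
        field_simp
      linarith
    have hj2 : N * (w i - m) ≤ N * T := mul_le_mul_of_nonneg_left hMT hN.le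
    rw [Real.norm_eq_abs, abs_le]
    have := hi j
    constructor <;> linarith

lemma exists_forall_jointDual_le (S : Setting K d x p) {δ : ℝ} (hδ : 0 < δ) :
    ∃ θ : ℝ × (Fin N → ℝ), 0 ≤ θ.1 ∧
      ∀ η : ℝ × (Fin N → ℝ), 0 ≤ η.1 → jointDual K d x p δ η ≤ jointDual K d x p δ θ := by
  obtain ⟨R, hR⟩ := S.exists_bound_of_le_jointDual hδ (jointDual K d x p δ 0)
  obtain ⟨b, hb, h⟩ := exists_forall_le_of_bounded_superlevel (S.continuous_jointDual δ)
    (isClosed_le continuous_const continuous_fst) (a := 0) (show (0 : ℝ) ≤ 0 from le_rfl) R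
    (fun b hb => hR b hb)
  exact ⟨b, hb, h⟩

lemma exists_isDualMaximizer (S : Setting K d x p) {δ : ℝ} (hδ : 0 < δ) {lam : Fin N → ℝ}
    (hlam : lam ∈ weightSpace N) : ∃ u v : ℝ, IsDualMaximizer K d x p δ lam u v := by
  have := S.nonempty
  obtain ⟨R, hR⟩ := S.exists_bound_of_le_jointDual hδ
    (jointDual K d x p δ (0, fun i => 0 * lam i - 0))
  have hcont : Continuous fun w : ℝ × ℝ =>
      jointDual K d x p δ (w.2, fun i => w.2 * lam i - w.1) :=
    (S.continuous_jointDual δ).comp (by fun_prop)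
  have hbd : ∀ w ∈ {w : ℝ × ℝ | 0 ≤ w.2},
      jointDual K d x p δ ((0 : ℝ × ℝ).2, fun i => (0 : ℝ × ℝ).2 * lam i - (0 : ℝ × ℝ).1) ≤
        jointDual K d x p δ (w.2, fun i => w.2 * lam i - w.1) → ‖w‖ ≤ R + R * ‖lam‖ := by
    intro w hw hle
    have h1 := hR (w.2, fun i => w.2 * lam i - w.1) hw hle
    rw [Prod.norm_def, max_le_iff] at h1
    simp only at h1
    have hR0 : 0 ≤ R := (norm_nonneg _).trans h1.1
    have h3 : 0 ≤ R * ‖lam‖ := mul_nonneg hR0 (norm_nonneg _)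
    rw [Prod.norm_def, max_le_iff]
    refine ⟨?_, h1.1.trans (by linarith)⟩
    let i : Fin N := Classical.arbitrary _
    have h2 : ‖w.2 * lam i - w.1‖ ≤ R :=
      (norm_le_pi_norm (fun i => w.2 * lam i - w.1) i).trans h1.2
    have h4 : ‖w.2 * lam i‖ ≤ R * ‖lam‖ := by
      rw [norm_mul]
      exact mul_le_mul h1.1 (norm_le_pi_norm lam i) (norm_nonneg _) hR0
    have h5 := norm_sub_le (w.2 * lam i) (w.2 * lam i - w.1)
    rw [sub_sub_cancel] at h5
    linarith
  obtain ⟨w, hw, h⟩ := exists_forall_le_of_bounded_superlevel hcont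
    (isClosed_le continuous_const continuous_snd) (show (0 : ℝ) ≤ 0 from le_rfl) _ hbd
  refine ⟨w.1, w.2, hw, fun u' v' hv' => ?_⟩
  rw [S.dualObjective_eq_jointDual δ hlam _ hv', S.dualObjective_eq_jointDual δ hlam _ hw]
  exact h (u', v') hv'

lemma concaveOn_dualObjective (S : Setting K d x p) (δ : ℝ) {lam : Fin N → ℝ}
    (hlam : lam ∈ weightSpace N) :
    ConcaveOn ℝ {w : ℝ × ℝ | 0 ≤ w.2} (dualObjective K d x p δ lam) := by
  have hconv : Convex ℝ {w : ℝ × ℝ | 0 ≤ w.2} := by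
    intro a ha b hb s t hs ht _
    exact add_nonneg (mul_nonneg hs ha) (mul_nonneg ht hb)
  refine ⟨hconv, fun a ha b hb s t hs ht hst => ?_⟩
  have h := (S.concaveOn_jointDual δ).2 (Set.mem_univ (a.2, fun i => a.2 * lam i - a.1))
    (Set.mem_univ (b.2, fun i => b.2 * lam i - b.1)) hs ht hst
  have hab : 0 ≤ (s • a + t • b).2 := hconv ha hb hs ht hst
  rw [show a = (a.1, a.2) from rfl, show b = (b.1, b.2) from rfl,
    S.dualObjective_eq_jointDual δ hlam _ ha, S.dualObjective_eq_jointDual δ hlam _ hb]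
  refine h.trans (le_of_eq ?_)
  rw [show s • (a.1, a.2) + t • (b.1, b.2) = ((s • a + t • b).1, (s • a + t • b).2) from rfl,
    S.dualObjective_eq_jointDual δ hlam _ hab]
  congr 1
  ext1
  · rfl
  · ext i
    simp
    ring

/-- First-order condition at a maximizer of the dual problem of `Γ(λ)`, in the direction
`(a, b)`. -/
lemma integral_le_of_isDualMaximizer (S : Setting K d x p) {δ : ℝ} {lam : Fin N → ℝ} {u v : ℝ}
    (h : IsDualMaximizer K d x p δ lam u v) (a b : ℝ) (hb : ∀ t : ℝ, 0 < t → t ≤ 1 → 0 ≤ v + t * b) :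
    a * (∫ y in K, expDensity d x p lam u v y) +
      b * (∫ y in K, phi d x lam y * expDensity d x p lam u v y) ≤ a + b * δ := by
  have hq := S.expDensity_integrableOn lam u v
  have hφ := S.phi_continuousOn lam
  have key := integral_mul_le_of_forall_integral_exp S.isCompact hq
    (fun y hy => (S.expDensity_pos lam u v hy).le)
    (g := fun y => a + b * phi d x lam y)
    (continuousOn_const.add (continuousOn_const.mul hφ)) (c := a + b * δ) (fun t ht ht1 => ?_)
  · rw [← integral_const_mul, ← integral_const_mul, ← integral_add (hq.const_mul a)
      ((S.integrableOn_mul hφ hq).const_mul b)]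
    refine le_trans (le_of_eq ?_) key
    refine integral_congr_ae (Filter.Eventually.of_forall fun y => ?_)
    simp only; ring
  · have h1 := h.2 (u + t * a) (v + t * b) (hb t ht ht1)
    simp only [dualObjective] at h1
    have e1 : ∫ y in K, p y * Real.exp (-(1 + (v + t * b) * phi d x lam y + (u + t * a))) =
        ∫ y in K, expDensity d x p lam u v y * Real.exp (-(t * (a + b * phi d x lam y))) := by
      refine integral_congr_ae (Filter.Eventually.of_forall fun y => ?_)
      simp only [expDensity, mul_assoc, ← Real.exp_add]
      congr 2; ring
    have e2 : ∫ y in K, p y * Real.exp (-(1 + v * phi d x lam y + u)) =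
        ∫ y in K, expDensity d x p lam u v y := by
      refine integral_congr_ae (Filter.Eventually.of_forall fun y => ?_)
      simp only [expDensity]
      congr 2; ring
    rw [e1, e2] at h1
    linarith

/-- The Karush–Kuhn–Tucker conditions at a maximizer of the dual problem of `Γ(λ)`. -/
lemma kkt_of_isDualMaximizer (S : Setting K d x p) {δ : ℝ} {lam : Fin N → ℝ} {u v : ℝ}
    (h : IsDualMaximizer K d x p δ lam u v) :
    ∫ y in K, expDensity d x p lam u v y = 1 ∧
    ∫ y in K, phi d x lam y * expDensity d x p lam u v y ≤ δ ∧
    v * ((∫ y in K, phi d x lam y * expDensity d x p lam u v y) - δ) = 0 := by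
  have hv := h.1
  have h1 := S.integral_le_of_isDualMaximizer h 1 0 (fun t ht _ => by linarith)
  have h2 := S.integral_le_of_isDualMaximizer h (-1) 0 (fun t ht _ => by linarith)
  have h3 := S.integral_le_of_isDualMaximizer h 0 1 (fun t ht _ => by linarith)
  have h4 := S.integral_le_of_isDualMaximizer h 0 (-v) (fun t _ ht => by nlinarith)
  have h5 := mul_le_mul_of_nonneg_left h3 hv
  refine ⟨by linarith, by linarith, le_antisymm (by linarith) (by linarith)⟩

/-- First-order condition at a maximizer of the joint dual problem, in the direction `(1, λ)`. -/
lemma integral_phi_gibbs_le (S : Setting K d x p) {δ : ℝ} {θ : ℝ × (Fin N → ℝ)} (hθ : 0 ≤ θ.1)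
    (hmax : ∀ η : ℝ × (Fin N → ℝ), 0 < η.1 → jointDual K d x p δ η ≤ jointDual K d x p δ θ)
    {lam : Fin N → ℝ} (hlam : lam ∈ weightSpace N) :
    ∫ y in K, phi d x lam y * gibbs d x p θ y ≤ δ := by
  have := S.nonempty
  have hφ := S.phi_continuousOn lam
  refine integral_mul_le_of_forall_integral_exp S.isCompact (S.gibbs_integrableOn θ)
    (fun y hy => (S.gibbs_pos θ hy).le) hφ (fun t ht _ => ?_)
  have h1 := hmax (θ + t • (1, lam)) (by simpa using add_pos_of_nonneg_of_pos hθ ht)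
  have hs : ∑ i, (θ + t • ((1 : ℝ), lam)).2 i = ∑ i, θ.2 i := by
    have : ∑ i, lam i = 0 := hlam
    simp [Finset.sum_add_distrib, ← Finset.mul_sum, this]
  simp only [jointDual, hs] at h1
  have h2 : ∫ y in K, gibbs d x p (θ + t • ((1 : ℝ), lam)) y ≤
      ∫ y in K, gibbs d x p θ y * Real.exp (-(t * phi d x lam y)) := by
    refine setIntegral_mono_on (S.gibbs_integrableOn _) ((S.gibbs_integrableOn θ).mul_continuousOn
      (continuousOn_const.mul hφ).neg.rexp S.isCompact) S.measurableSet fun y hy => ?_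
    have h3 := psi_add_le (d := d) (x := x) θ (t • (1, lam)) y
    rw [psi_smul ht.le, ← phi_eq_psi] at h3
    rw [gibbs, gibbs, mul_assoc, ← Real.exp_add]
    refine mul_le_mul_of_nonneg_left (Real.exp_le_exp.2 ?_) (S.ppos y hy).le
    linarith
  simp only [Prod.fst_add, Prod.smul_fst, smul_eq_mul] at h1
  linarith

end Setting

/-! ### Gibbs' inequality and Lagrangian duality -/

/-- The pointwise form of Gibbs' inequality, with its case of equality. -/
lemma neg_mul_exp_le_log_div_mul {a b : ℝ} (ha : 0 ≤ a) (hb : 0 < b) (c : ℝ) :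
    -(b * Real.exp (-(1 + c))) ≤ Real.log (a / b) * a + c * a ∧
    (Real.log (a / b) * a + c * a = -(b * Real.exp (-(1 + c))) →
      a = b * Real.exp (-(1 + c))) := by
  set r := b * Real.exp (-(1 + c)) with hr
  have hrpos : 0 < r := mul_pos hb (Real.exp_pos _)
  rcases ha.eq_or_lt with rfl | ha
  · simp only [mul_zero, add_zero]
    exact ⟨by linarith, fun h => by linarith⟩
  have hlog : Real.log (a / b) + c = Real.log (a / r) - 1 := by
    rw [Real.log_div ha.ne' hb.ne', Real.log_div ha.ne' hrpos.ne', hr,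
      Real.log_mul hb.ne' (Real.exp_pos _).ne', Real.log_exp]
    ring
  have hinv : Real.log (a / r) = -Real.log (r / a) := by rw [← Real.log_inv, inv_div]
  have hval : Real.log (a / b) * a + c * a = -(Real.log (r / a) + 1) * a := by
    rw [← add_mul, hlog, hinv]; ring
  have hra : r / a * a = r := div_mul_cancel₀ r ha.ne'
  rw [hval]
  constructor
  · have := mul_le_mul_of_nonneg_right (Real.log_le_sub_one_of_pos (div_pos hrpos ha)) ha.le
    linarith
  · intro h
    by_contra hne
    have h1 : r / a ≠ 1 := fun h1 => hne (by rw [div_eq_one_iff_eq ha.ne'] at h1; exact h1.symm)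
    have := mul_lt_mul_of_pos_right (Real.log_lt_sub_one_of_pos (div_pos hrpos ha) h1) ha
    linarith

lemma expDensity_apply {n N : ℕ} (d : EuclideanSpace ℝ (Fin n) → EuclideanSpace ℝ (Fin n) → ℝ)
    (x : Fin N → EuclideanSpace ℝ (Fin n)) (p : EuclideanSpace ℝ (Fin n) → ℝ)
    (lam : Fin N → ℝ) (u v : ℝ) (y : EuclideanSpace ℝ (Fin n)) :
    expDensity d x p lam u v y = p y * Real.exp (-(1 + (v * phi d x lam y + u))) := by
  rw [expDensity]
  congr 2; ring

namespace Setting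

variable {n N : ℕ} {K : Set (EuclideanSpace ℝ (Fin n))}
  {d : EuclideanSpace ℝ (Fin n) → EuclideanSpace ℝ (Fin n) → ℝ}
  {x : Fin N → EuclideanSpace ℝ (Fin n)} {p : EuclideanSpace ℝ (Fin n) → ℝ} {δ : ℝ}
  {lam : Fin N → ℝ} {u v : ℝ} {q : EuclideanSpace ℝ (Fin n) → ℝ}

/-- Gibbs' variational inequality. -/
lemma neg_integral_le_crossEntropy_add (S : Setting K d x p) (hq : q ∈ nonnegCone K)
    {g : EuclideanSpace ℝ (Fin n) → ℝ} (hg : ContinuousOn g K) :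
    ((-∫ y in K, p y * Real.exp (-(1 + g y)) : ℝ) : EReal) ≤
      crossEntropy K q p + ((∫ y in K, g y * q y : ℝ) : EReal) := by
  rw [crossEntropy]
  split_ifs with h
  · rw [← EReal.coe_add, EReal.coe_le_coe_iff, ← integral_add h (S.integrableOn_mul hg hq.1),
      ← integral_neg]
    refine integral_mono_ae ?_ (h.add (S.integrableOn_mul hg hq.1)) ?_
    · exact ((S.cont.mul (continuousOn_const.add hg).neg.rexp).integrableOn_compact
        S.isCompact).neg
    · filter_upwards [hq.2, ae_restrict_mem S.measurableSet] with y hy hyK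
      exact (neg_mul_exp_le_log_div_mul hy (S.ppos y hyK) (g y)).1
  · rw [EReal.top_add_coe]
    exact le_top

/-- The case of equality in Gibbs' variational inequality. -/
lemma ae_eq_of_crossEntropy_add_le (S : Setting K d x p) (hq : q ∈ nonnegCone K)
    {g : EuclideanSpace ℝ (Fin n) → ℝ} (hg : ContinuousOn g K)
    (hle : crossEntropy K q p + ((∫ y in K, g y * q y : ℝ) : EReal) ≤
      ((-∫ y in K, p y * Real.exp (-(1 + g y)) : ℝ) : EReal)) :
    q =ᵐ[volume.restrict K] fun y => p y * Real.exp (-(1 + g y)) := by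
  rw [crossEntropy] at hle
  split_ifs at hle with h
  · rw [← EReal.coe_add, EReal.coe_le_coe_iff, ← integral_add h (S.integrableOn_mul hg hq.1)]
      at hle
    have hr : IntegrableOn (fun y => p y * Real.exp (-(1 + g y))) K :=
      (S.cont.mul (continuousOn_const.add hg).neg.rexp).integrableOn_compact S.isCompact
    have hl := h.add (S.integrableOn_mul hg hq.1)
    have hnn : 0 ≤ᵐ[volume.restrict K] fun y =>
        (Real.log (q y / p y) * q y + g y * q y) + p y * Real.exp (-(1 + g y)) := by
      filter_upwards [hq.2, ae_restrict_mem S.measurableSet] with y hy hyK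
      have := (neg_mul_exp_le_log_div_mul hy (S.ppos y hyK) (g y)).1
      simp only [Pi.zero_apply]
      linarith
    have hint : ∫ y in K, ((Real.log (q y / p y) * q y + g y * q y) +
        p y * Real.exp (-(1 + g y))) = 0 := by
      apply le_antisymm _ (integral_nonneg_of_ae hnn)
      rw [integral_add (f := fun y => Real.log (q y / p y) * q y + g y * q y) hl hr]
      linarith
    rw [integral_eq_zero_iff_of_nonneg_ae hnn (hl.add hr)] at hint
    filter_upwards [hint, hq.2, ae_restrict_mem S.measurableSet] with y hy0 hy hyK
    simp only [Pi.zero_apply] at hy0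
    exact (neg_mul_exp_le_log_div_mul hy (S.ppos y hyK) (g y)).2 (by linarith)
  · rw [EReal.top_add_coe, top_le_iff] at hle
    exact absurd hle (EReal.coe_ne_top _)

lemma integral_mul_phi_add (S : Setting K d x p) (hq : IntegrableOn q K) (lam : Fin N → ℝ)
    (u v : ℝ) : ∫ y in K, (v * phi d x lam y + u) * q y =
      v * (∫ y in K, phi d x lam y * q y) + u * ∫ y in K, q y := by
  rw [← integral_const_mul, ← integral_const_mul, ← integral_add
    ((S.integrableOn_mul (S.phi_continuousOn lam) hq).const_mul v) (hq.const_mul u)]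
  refine integral_congr_ae (Filter.Eventually.of_forall fun y => ?_)
  simp only; ring

lemma dualObjective_eq (K : Set (EuclideanSpace ℝ (Fin n)))
    (d : EuclideanSpace ℝ (Fin n) → EuclideanSpace ℝ (Fin n) → ℝ)
    (x : Fin N → EuclideanSpace ℝ (Fin n)) (p : EuclideanSpace ℝ (Fin n) → ℝ) (δ : ℝ)
    (lam : Fin N → ℝ) (u v : ℝ) : dualObjective K d x p δ lam (u, v) =
      -u - v * δ - ∫ y in K, p y * Real.exp (-(1 + (v * phi d x lam y + u))) := by
  simp only [dualObjective, add_assoc]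

lemma dualObjective_eq_expDensity (K : Set (EuclideanSpace ℝ (Fin n)))
    (d : EuclideanSpace ℝ (Fin n) → EuclideanSpace ℝ (Fin n) → ℝ)
    (x : Fin N → EuclideanSpace ℝ (Fin n)) (p : EuclideanSpace ℝ (Fin n) → ℝ) (δ : ℝ)
    (lam : Fin N → ℝ) (u v : ℝ) : dualObjective K d x p δ lam (u, v) =
      -u - v * δ - ∫ y in K, expDensity d x p lam u v y := by
  simp only [dualObjective_eq, expDensity_apply]

lemma continuousOn_mul_phi_add (S : Setting K d x p) (lam : Fin N → ℝ) (u v : ℝ) :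
    ContinuousOn (fun y => v * phi d x lam y + u) K :=
  (continuousOn_const.mul (S.phi_continuousOn lam)).add continuousOn_const

lemma lagrangian_eq (S : Setting K d x p) (hq : IntegrableOn q K) (δ : ℝ) (lam : Fin N → ℝ)
    (u v : ℝ) : lagrangian K d x p δ lam q u v =
      crossEntropy K q p + ((∫ y in K, (v * phi d x lam y + u) * q y : ℝ) : EReal) +
        ((-u - v * δ : ℝ) : EReal) := by
  rw [lagrangian, S.integral_mul_phi_add hq, add_assoc, ← EReal.coe_add]
  congr 2; ring

lemma dualObjective_le_lagrangian (S : Setting K d x p) (hq : q ∈ nonnegCone K) (δ : ℝ)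
    (lam : Fin N → ℝ) (u v : ℝ) :
    ((dualObjective K d x p δ lam (u, v) : ℝ) : EReal) ≤ lagrangian K d x p δ lam q u v := by
  rw [S.lagrangian_eq hq.1, dualObjective_eq]
  refine le_trans (le_of_eq ?_)
    (add_le_add_left (S.neg_integral_le_crossEntropy_add hq
      (S.continuousOn_mul_phi_add lam u v)) _)
  rw [← EReal.coe_add]
  congr 1; ring

lemma expDensity_mem_nonnegCone (S : Setting K d x p) (lam : Fin N → ℝ) (u v : ℝ) :
    expDensity d x p lam u v ∈ nonnegCone K :=
  ⟨S.expDensity_integrableOn lam u v, by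
    filter_upwards [ae_restrict_mem S.measurableSet] with y hy using (S.expDensity_pos _ _ _ hy).le⟩

lemma crossEntropy_expDensity (S : Setting K d x p) (lam : Fin N → ℝ) (u v : ℝ) :
    crossEntropy K (expDensity d x p lam u v) p =
      ((-(∫ y in K, expDensity d x p lam u v y) -
        ∫ y in K, (v * phi d x lam y + u) * expDensity d x p lam u v y : ℝ) : EReal) := by
  have hq := S.expDensity_integrableOn lam u v
  have hgq := S.integrableOn_mul (S.continuousOn_mul_phi_add lam u v) hq
  have heq : (fun y => -expDensity d x p lam u v y -
      (v * phi d x lam y + u) * expDensity d x p lam u v y) =ᵐ[volume.restrict K]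
      fun y => Real.log (expDensity d x p lam u v y / p y) * expDensity d x p lam u v y := by
    filter_upwards [ae_restrict_mem S.measurableSet] with y hy
    have : Real.log (expDensity d x p lam u v y / p y) = -(1 + (v * phi d x lam y + u)) := by
      rw [expDensity_apply, mul_div_cancel_left₀ _ (S.ppos y hy).ne', Real.log_exp]
    rw [this]; ring
  have hint : IntegrableOn (fun y => Real.log (expDensity d x p lam u v y / p y) *
      expDensity d x p lam u v y) K := (hq.neg.sub hgq).congr heq
  rw [crossEntropy, if_pos hint, EReal.coe_eq_coe_iff, ← integral_congr_ae heq,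
    integral_sub (f := fun y => -expDensity d x p lam u v y) hq.neg hgq, integral_neg]

lemma lagrangian_expDensity (S : Setting K d x p) (δ : ℝ) (lam : Fin N → ℝ) (u v : ℝ) :
    lagrangian K d x p δ lam (expDensity d x p lam u v) u v =
      ((dualObjective K d x p δ lam (u, v) : ℝ) : EReal) := by
  rw [S.lagrangian_eq (S.expDensity_integrableOn lam u v), S.crossEntropy_expDensity,
    dualObjective_eq_expDensity, ← EReal.coe_add, ← EReal.coe_add]
  congr 1; ring

lemma dualFunction_eq (S : Setting K d x p) (δ : ℝ) (lam : Fin N → ℝ) (u v : ℝ) :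
    dualFunction K d x p δ lam u v = ((dualObjective K d x p δ lam (u, v) : ℝ) : EReal) := by
  apply le_antisymm
  · rw [← S.lagrangian_expDensity]
    exact iInf₂_le _ (S.expDensity_mem_nonnegCone lam u v)
  · exact le_iInf₂ fun q hq => S.dualObjective_le_lagrangian hq δ lam u v

/-- Weak duality, with the slack of the constraint kept. -/
lemma dualObjective_le_crossEntropy_add (S : Setting K d x p) (hq : q ∈ densities K) (δ : ℝ)
    (lam : Fin N → ℝ) (u v : ℝ) :
    ((dualObjective K d x p δ lam (u, v) : ℝ) : EReal) ≤
      crossEntropy K q p + ((v * ((∫ y in K, phi d x lam y * q y) - δ) : ℝ) : EReal) := by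
  have h := S.dualObjective_le_lagrangian hq.1 δ lam u v
  rwa [lagrangian, hq.2, sub_self, mul_zero, add_zero] at h

lemma dualObjective_le_crossEntropy (S : Setting K d x p) (hq : q ∈ feasibleSet K d x δ lam)
    (u : ℝ) (hv : 0 ≤ v) :
    ((dualObjective K d x p δ lam (u, v) : ℝ) : EReal) ≤ crossEntropy K q p := by
  refine (S.dualObjective_le_crossEntropy_add hq.1 δ lam u v).trans ?_
  have : ((v * ((∫ y in K, phi d x lam y * q y) - δ) : ℝ) : EReal) ≤ 0 := by
    exact_mod_cast mul_nonpos_of_nonneg_of_nonpos hv (sub_nonpos.2 hq.2)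
  simpa using add_le_add_right this (crossEntropy K q p)

/-- A feasible density whose entropy does not exceed a dual value is the corresponding
exponential density. -/
lemma ae_eq_expDensity_of_crossEntropy_le (S : Setting K d x p)
    (hq : q ∈ feasibleSet K d x δ lam) (hv : 0 ≤ v)
    (hle : crossEntropy K q p ≤ ((dualObjective K d x p δ lam (u, v) : ℝ) : EReal)) :
    q =ᵐ[volume.restrict K] expDensity d x p lam u v := by
  have h : q =ᵐ[volume.restrict K] fun y => p y * Real.exp (-(1 + (v * phi d x lam y + u))) := by
    refine S.ae_eq_of_crossEntropy_add_le hq.1.1 (S.continuousOn_mul_phi_add lam u v) ?_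
    refine (add_le_add_left hle _).trans ?_
    rw [← EReal.coe_add, EReal.coe_le_coe_iff, S.integral_mul_phi_add hq.1.1.1, hq.1.2,
      dualObjective_eq]
    have := mul_nonpos_of_nonneg_of_nonpos hv (sub_nonpos.2 hq.2)
    linarith
  simpa only [← expDensity_apply] using h

lemma expDensity_mem_feasibleSet (S : Setting K d x p)
    (h : IsDualMaximizer K d x p δ lam u v) :
    expDensity d x p lam u v ∈ feasibleSet K d x δ lam :=
  ⟨⟨S.expDensity_mem_nonnegCone lam u v, (S.kkt_of_isDualMaximizer h).1⟩,
    (S.kkt_of_isDualMaximizer h).2.1⟩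

lemma crossEntropy_expDensity_of_isDualMaximizer (S : Setting K d x p)
    (h : IsDualMaximizer K d x p δ lam u v) :
    crossEntropy K (expDensity d x p lam u v) p =
      ((dualObjective K d x p δ lam (u, v) : ℝ) : EReal) := by
  obtain ⟨h1, -, h3⟩ := S.kkt_of_isDualMaximizer h
  rw [S.crossEntropy_expDensity, dualObjective_eq_expDensity,
    S.integral_mul_phi_add (S.expDensity_integrableOn lam u v), h1]
  congr 1
  linarith

/-- Strong duality. -/
lemma gam_eq_dualObjective (S : Setting K d x p) (h : IsDualMaximizer K d x p δ lam u v) :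
    Gam K d x p δ lam = ((dualObjective K d x p δ lam (u, v) : ℝ) : EReal) := by
  apply le_antisymm
  · rw [← S.crossEntropy_expDensity_of_isDualMaximizer h]
    exact iInf₂_le _ (S.expDensity_mem_feasibleSet h)
  · exact le_iInf₂ fun q hq => S.dualObjective_le_crossEntropy hq u h.1

/-- Quasi-concavity: by concavity of `λ ↦ φ_λ`, a density feasible for a convex combination of two
weights is feasible for one of the two. -/
lemma quasiconcaveOn_gam (S : Setting K d x p) (δ : ℝ) :
    QuasiconcaveOn ℝ (weightSpace N) (Gam K d x p δ) := by
  have := S.nonempty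
  rintro r l1 ⟨h1, hr1⟩ l2 ⟨h2, hr2⟩ a b ha hb hab
  have hmem : a • l1 + b • l2 ∈ weightSpace N := by
    have h1' : ∑ i, l1 i = 0 := h1
    have h2' : ∑ i, l2 i = 0 := h2
    simp [weightSpace, Finset.sum_add_distrib, ← Finset.mul_sum, h1', h2']
  refine ⟨hmem, le_iInf₂ fun q hq => ?_⟩
  have hi1 := S.integrableOn_mul (S.phi_continuousOn l1) hq.1.1.1
  have hi2 := S.integrableOn_mul (S.phi_continuousOn l2) hq.1.1.1
  have hint : a * (∫ y in K, phi d x l1 y * q y) + b * (∫ y in K, phi d x l2 y * q y) ≤ δ := by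
    refine le_trans ?_ hq.2
    rw [← integral_const_mul, ← integral_const_mul,
      ← integral_add (hi1.const_mul a) (hi2.const_mul b)]
    refine integral_mono_ae ((hi1.const_mul a).add (hi2.const_mul b))
      (S.integrableOn_mul (S.phi_continuousOn _) hq.1.1.1) ?_
    filter_upwards [hq.1.1.2] with y hy
    have h3 : a * phi d x l1 y + b * phi d x l2 y ≤ phi d x (a • l1 + b • l2) y := by
      refine le_phi fun i => ?_
      have e1 := mul_le_mul_of_nonneg_left (phi_le (d := d) (x := x) l1 y i) ha
      have e2 := mul_le_mul_of_nonneg_left (phi_le (d := d) (x := x) l2 y i) hb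
      simp only [Pi.add_apply, Pi.smul_apply, smul_eq_mul]
      linear_combination e1 + e2 + d y (x i) * hab
    have := mul_le_mul_of_nonneg_right h3 hy
    linarith
  by_cases hc : ∫ y in K, phi d x l1 y * q y ≤ δ
  · exact hr1.trans (iInf₂_le q ⟨hq.1, hc⟩)
  · by_cases hc2 : ∫ y in K, phi d x l2 y * q y ≤ δ
    · exact hr2.trans (iInf₂_le q ⟨hq.1, hc2⟩)
    · exfalso
      push Not at hc hc2
      rcases ha.eq_or_lt with rfl | ha
      · rw [zero_add] at hab; subst hab; linarith
      · have := mul_lt_mul_of_pos_left hc ha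
        have := mul_le_mul_of_nonneg_left hc2.le hb
        have : a * δ + b * δ = δ := by rw [← add_mul, hab, one_mul]
        linarith

end Setting

/-! ### Semi-discrete optimal transport -/

namespace Setting

variable {n N : ℕ} {K : Set (EuclideanSpace ℝ (Fin n))}
  {d : EuclideanSpace ℝ (Fin n) → EuclideanSpace ℝ (Fin n) → ℝ}
  {x : Fin N → EuclideanSpace ℝ (Fin n)} {p : EuclideanSpace ℝ (Fin n) → ℝ} {δ : ℝ}
  {lam : Fin N → ℝ} {u v : ℝ} {q g : EuclideanSpace ℝ (Fin n) → ℝ}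

lemma aemeasurable_ofReal (hq : IntegrableOn q K) :
    AEMeasurable (fun y => ENNReal.ofReal (q y)) (volume.restrict K) :=
  hq.aemeasurable.ennreal_ofReal

lemma setIntegral_densityMeasure (hq : q ∈ nonnegCone K) {s : Set (EuclideanSpace ℝ (Fin n))}
    (hs : MeasurableSet s) (hsK : s ⊆ K) (g : EuclideanSpace ℝ (Fin n) → ℝ) :
    ∫ y in s, g y ∂densityMeasure K q = ∫ y in s, g y * q y := by
  have hle : volume.restrict s ≤ volume.restrict K := Measure.restrict_mono hsK le_rfl
  rw [densityMeasure, restrict_withDensity hs, Measure.restrict_restrict hs,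
    Set.inter_eq_left.2 hsK, integral_withDensity_eq_integral_toReal_smul₀
      ((aemeasurable_ofReal hq.1).mono_measure hle) (by simp)]
  refine integral_congr_ae ?_
  filter_upwards [ae_mono hle hq.2] with y hy
  simp only [smul_eq_mul, ENNReal.toReal_ofReal hy, mul_comm]

lemma integral_densityMeasure (hq : q ∈ nonnegCone K) (g : EuclideanSpace ℝ (Fin n) → ℝ) :
    ∫ y, g y ∂densityMeasure K q = ∫ y in K, g y * q y := by
  rw [densityMeasure, integral_withDensity_eq_integral_toReal_smul₀
      (aemeasurable_ofReal hq.1) (by simp)]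
  refine integral_congr_ae ?_
  filter_upwards [hq.2] with y hy
  simp only [smul_eq_mul, ENNReal.toReal_ofReal hy, mul_comm]

lemma integrable_densityMeasure (S : Setting K d x p) (hq : q ∈ nonnegCone K)
    (hg : ContinuousOn g K) : Integrable g (densityMeasure K q) := by
  rw [densityMeasure, integrable_withDensity_iff_integrable_smul₀' (aemeasurable_ofReal hq.1)
    (by simp)]
  refine (S.integrableOn_mul hg hq.1).congr ?_
  filter_upwards [hq.2] with y hy
  simp only [smul_eq_mul, ENNReal.toReal_ofReal hy, mul_comm]

lemma isProbabilityMeasure_densityMeasure (hq : q ∈ densities K) :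
    IsProbabilityMeasure (densityMeasure K q) := by
  refine ⟨?_⟩
  rw [densityMeasure, withDensity_apply _ MeasurableSet.univ, Measure.restrict_univ,
    ← ofReal_integral_eq_lintegral_ofReal hq.1.1 hq.1.2, hq.2, ENNReal.ofReal_one]

lemma densityMeasure_ac (K : Set (EuclideanSpace ℝ (Fin n)))
    (q : EuclideanSpace ℝ (Fin n) → ℝ) : densityMeasure K q ≪ volume.restrict K :=
  withDensity_absolutelyContinuous _ _

/-- The weak half of Kantorovich duality: each `φ_λ` with `∑ λᵢ = 0` bounds the transport cost to
the empirical measure from below. -/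
lemma ofReal_integral_phi_le_wasserstein (S : Setting K d x p) (hq : q ∈ densities K)
    (hlam : lam ∈ weightSpace N) :
    ENNReal.ofReal (∫ y in K, phi d x lam y * q y) ≤
      wasserstein K d (densityMeasure K q) (empiricalMeasure x) := by
  classical
  have hN : (N : ℝ≥0∞) ≠ 0 := by exact_mod_cast S.pos.ne'
  refine le_iInf₂ fun π ⟨h1, h2⟩ => ?_
  have := isProbabilityMeasure_densityMeasure hq
  have hπ : IsProbabilityMeasure π := by
    refine ⟨?_⟩
    have : π.map Prod.fst Set.univ = 1 := by rw [h1]; exact measure_univ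
    rwa [Measure.map_apply measurable_fst MeasurableSet.univ, Set.preimage_univ] at this
  have hfst : ∀ᵐ z ∂π, z.1 ∈ K := by
    refine ae_of_ae_map (p := fun y => y ∈ K) measurable_fst.aemeasurable ?_
    rw [h1]
    exact (densityMeasure_ac K q).ae_le (ae_restrict_mem S.measurableSet)
  have hsnd : ∀ᵐ z ∂π, ∃ i, z.2 = x i := by
    refine ae_of_ae_map (p := fun y => ∃ i, y = x i) measurable_snd.aemeasurable ?_
    rw [h2, empiricalMeasure]
    refine Measure.ae_smul_measure ?_ _
    have hm : MeasurableSet {y | ¬ ∃ i, y = x i} := by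
      have : {y | ¬ ∃ i, y = x i} = (Set.range x)ᶜ := by ext; simp [eq_comm]
      rw [this]; exact (Set.finite_range x).measurableSet.compl
    rw [ae_iff, Measure.finsetSum_apply]
    refine Finset.sum_eq_zero fun i _ => ?_
    rw [Measure.dirac_apply' _ hm]
    simp
  have hmem : ∀ᵐ z ∂π, z ∈ K ×ˢ K := by
    filter_upwards [hfst, hsnd] with z hz1 ⟨i, hi⟩
    exact ⟨hz1, hi ▸ S.mem i⟩
  have hrestr := Measure.restrict_eq_self_of_ae_mem hmem
  have hdint : Integrable (fun z : EuclideanSpace ℝ (Fin n) × EuclideanSpace ℝ (Fin n) =>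
      d z.1 z.2) π := by
    have := S.metric.continuousOn.integrableOn_compact (μ := π) (S.isCompact.prod S.isCompact)
    rwa [IntegrableOn, hrestr] at this
  rw [hrestr, ← ofReal_integral_eq_lintegral_ofReal hdint (by
    filter_upwards [hmem] with z hz using S.dist_nonneg hz.1 hz.2)]
  apply ENNReal.ofReal_le_ofReal
  -- The potential on the sites, extended by zero to a measurable function.
  let Λ : EuclideanSpace ℝ (Fin n) → ℝ := fun y => ∑ i, ({x i} : Set _).indicator (fun _ => lam i) y
  have hΛm : Measurable Λ := Finset.measurable_fun_sum _ fun i _ =>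
    measurable_const.indicator (measurableSet_singleton _)
  have hΛx : ∀ i, Λ (x i) = lam i := by
    intro i
    simp only [Λ, Set.indicator_apply, Set.mem_singleton_iff, S.injective.eq_iff]
    simp
  have hΛint : Integrable Λ (π.map Prod.snd) := by
    rw [h2, empiricalMeasure]
    refine Integrable.smul_measure ?_ (ENNReal.inv_ne_top.2 hN)
    rw [integrable_finsetSum_measure]
    intro i _
    exact integrable_dirac' hΛm.stronglyMeasurable (by simp)
  have hΛ0 : ∫ z, Λ z.2 ∂π = 0 := by
    rw [← integral_map measurable_snd.aemeasurable hΛm.aestronglyMeasurable, h2, empiricalMeasure,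
      integral_smul_measure, integral_finsetSum_measure
        (fun i _ => integrable_dirac' hΛm.stronglyMeasurable (by simp))]
    have hs : ∑ i, lam i = 0 := hlam
    simp [hΛx, hs]
  have hφint : Integrable (phi d x lam) (π.map Prod.fst) := by
    rw [h1]; exact S.integrable_densityMeasure hq.1 (S.phi_continuousOn lam)
  have hφ : ∫ z, phi d x lam z.1 ∂π = ∫ y in K, phi d x lam y * q y := by
    rw [← integral_map measurable_fst.aemeasurable hφint.aestronglyMeasurable, h1,
      integral_densityMeasure hq.1]
  have hφint' : Integrable (fun z : EuclideanSpace ℝ (Fin n) × EuclideanSpace ℝ (Fin n) =>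
      phi d x lam z.1) π := hφint.comp_measurable measurable_fst
  have hΛint' : Integrable (fun z : EuclideanSpace ℝ (Fin n) × EuclideanSpace ℝ (Fin n) =>
      Λ z.2) π := hΛint.comp_measurable measurable_snd
  have hsplit := integral_add hφint' hΛint'
  rw [hφ, hΛ0, add_zero] at hsplit
  rw [← hsplit]
  refine integral_mono_ae (hφint'.add hΛint') hdint ?_
  filter_upwards [hsnd] with z ⟨i, hi⟩
  have h3 := phi_le (d := d) (x := x) lam z.1 i
  have h4 : Λ z.2 = lam i := by rw [hi, hΛx]
  rw [h4, hi]
  linarith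

lemma isClosed_voronoiRegion (S : Setting K d x p) (lam : Fin N → ℝ) (i : Fin N) :
    IsClosed (voronoiRegion K d x lam i) := by
  have : voronoiRegion K d x lam i =
      K ∩ (fun y => d y (x i) - lam i - phi d x lam y) ⁻¹' Set.Iic 0 := by
    have := S.nonempty
    ext y
    simp only [voronoiRegion, Set.mem_ofPred_eq, Set.mem_inter_iff, Set.mem_preimage, Set.mem_Iic,
      sub_nonpos]
    exact and_congr_right fun _ => ⟨fun h => le_phi h, fun h j => h.trans (phi_le lam y j)⟩
  rw [this]
  exact (((S.continuousOn_dist i).sub continuousOn_const).sub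
    (S.phi_continuousOn lam)).preimage_isClosed_of_isClosed S.isCompact.isClosed isClosed_Iic

lemma measurableSet_voronoiRegion (S : Setting K d x p) (lam : Fin N → ℝ) (i : Fin N) :
    MeasurableSet (voronoiRegion K d x lam i) := (S.isClosed_voronoiRegion lam i).measurableSet

lemma voronoiRegion_subset (i : Fin N) : voronoiRegion K d x lam i ⊆ K := fun _ h => h.1

lemma phi_eq_of_mem_voronoiRegion (S : Setting K d x p) {i : Fin N}
    {y : EuclideanSpace ℝ (Fin n)} (hy : y ∈ voronoiRegion K d x lam i) :
    phi d x lam y = d y (x i) - lam i := by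
  have := S.nonempty
  exact le_antisymm (phi_le lam y i) (le_phi hy.2)

lemma mem_voronoiRegion_of_phi_eq {i : Fin N} {y : EuclideanSpace ℝ (Fin n)} (hyK : y ∈ K)
    (hy : phi d x lam y = d y (x i) - lam i) : y ∈ voronoiRegion K d x lam i :=
  ⟨hyK, fun j => hy ▸ phi_le lam y j⟩

lemma iUnion_voronoiRegion (S : Setting K d x p) (lam : Fin N → ℝ) :
    ⋃ i, voronoiRegion K d x lam i = K := by
  have := S.nonempty
  apply Set.Subset.antisymm (Set.iUnion_subset fun i => voronoiRegion_subset i)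
  intro y hy
  obtain ⟨i, hi⟩ := exists_phi_eq d x lam y
  exact Set.mem_iUnion.2 ⟨i, mem_voronoiRegion_of_phi_eq hy hi⟩

lemma aedisjoint_voronoiRegion (S : Setting K d x p) (lam : Fin N → ℝ) :
    Pairwise (Function.onFun (AEDisjoint volume) (voronoiRegion K d x lam)) := by
  intro i j hij
  refine measure_mono_null ?_ (S.null i j hij (lam i - lam j))
  rintro y ⟨hi, hj⟩
  refine ⟨hi.1, ?_⟩
  have h1 := hi.2 j
  have h2 := hj.2 i
  linarith

lemma sum_setIntegral_voronoiRegion (S : Setting K d x p) (lam : Fin N → ℝ)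
    (hg : IntegrableOn g K) : ∑ i, ∫ y in voronoiRegion K d x lam i, g y = ∫ y in K, g y := by
  have h := integral_iUnion_ae (f := g)
    (fun i => (S.measurableSet_voronoiRegion lam i).nullMeasurableSet)
    (S.aedisjoint_voronoiRegion lam) (by rwa [S.iUnion_voronoiRegion])
  rw [S.iUnion_voronoiRegion, tsum_fintype] at h
  exact h.symm

/-- On the region of `xᵢ` for `λ` one has `φ_λ' ≤ φ_λ - (λ'ᵢ - λᵢ)`; summing over the regions gives a
supergradient inequality for `λ ↦ ∫ φ_λ q`. -/
lemma integral_phi_le_add (S : Setting K d x p) (hq : q ∈ nonnegCone K) (lam lam' : Fin N → ℝ) :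
    ∫ y in K, phi d x lam' y * q y ≤ (∫ y in K, phi d x lam y * q y) -
      ∑ i, (lam' i - lam i) * ∫ y in voronoiRegion K d x lam i, q y := by
  have h1 := S.integrableOn_mul (S.phi_continuousOn lam) hq.1
  have h2 := S.integrableOn_mul (S.phi_continuousOn lam') hq.1
  rw [← S.sum_setIntegral_voronoiRegion lam h1, ← S.sum_setIntegral_voronoiRegion lam h2,
    ← Finset.sum_sub_distrib]
  refine Finset.sum_le_sum fun i _ => ?_
  have hsub := voronoiRegion_subset (K := K) (d := d) (x := x) (lam := lam) i
  rw [← integral_const_mul, ← integral_sub (h1.mono_set hsub) ((hq.1.mono_set hsub).const_mul _)]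
  refine integral_mono_ae (h2.mono_set hsub)
    ((h1.mono_set hsub).sub ((hq.1.mono_set hsub).const_mul _)) ?_
  filter_upwards [ae_restrict_mem (S.measurableSet_voronoiRegion lam i),
    ae_restrict_of_ae_restrict_of_subset hsub hq.2] with y hy hqy
  have h3 := phi_le (d := d) (x := x) lam' y i
  have h4 : phi d x lam' y ≤ phi d x lam y - (lam' i - lam i) := by
    rw [S.phi_eq_of_mem_voronoiRegion hy]; linarith
  have := mul_le_mul_of_nonneg_right h4 hqy
  linarith

/-- If all Voronoi regions carry the same mass, sending each region to its site is a transport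
plan, so the transport cost is at most `∫ φ_λ q`. -/
lemma wasserstein_le_of_setIntegral_eq (S : Setting K d x p) (hq : q ∈ densities K)
    (hlam : lam ∈ weightSpace N)
    (hmass : ∀ i, ∫ y in voronoiRegion K d x lam i, q y = 1 / N) :
    wasserstein K d (densityMeasure K q) (empiricalMeasure x) ≤
      ENNReal.ofReal (∫ y in K, phi d x lam y * q y) := by
  have hN : (0 : ℝ) < N := by exact_mod_cast S.pos
  have := isProbabilityMeasure_densityMeasure hq
  set ν := densityMeasure K q with hν
  set R := voronoiRegion K d x lam with hR
  have hRm : ∀ i, MeasurableSet (R i) := S.measurableSet_voronoiRegion lam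
  have hRK : ∀ i, R i ⊆ K := fun i => voronoiRegion_subset i
  have hmassν : ∀ i, ν (R i) = (N : ℝ≥0∞)⁻¹ := by
    intro i
    have h1 := setIntegral_densityMeasure hq.1 (hRm i) (hRK i) (fun _ => (1 : ℝ))
    simp only [one_mul, hmass i] at h1
    rw [setIntegral_const, smul_eq_mul, mul_one] at h1
    rw [← ENNReal.ofReal_toReal (measure_ne_top ν (R i)), ← measureReal_def, h1,
      ENNReal.ofReal_div_of_pos hN, ENNReal.ofReal_one, ENNReal.ofReal_natCast, one_div]
  have hpair : ∀ i, Measurable fun y : EuclideanSpace ℝ (Fin n) => (y, x i) :=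
    fun i => measurable_id.prodMk measurable_const
  let π := Measure.sum fun i => (ν.restrict (R i)).map fun y => (y, x i)
  have hfst : π.map Prod.fst = ν := by
    have hd : Pairwise (Function.onFun (AEDisjoint ν) R) := fun i j hij =>
      (densityMeasure_ac K q).trans Measure.restrict_le_self.absolutelyContinuous
        (S.aedisjoint_voronoiRegion lam hij)
    have h2 := Measure.restrict_iUnion_ae hd fun i => (hRm i).nullMeasurableSet
    have h3 : ν.restrict (⋃ i, R i) = ν := by
      rw [S.iUnion_voronoiRegion]
      exact Measure.restrict_eq_self_of_ae_mem
        ((densityMeasure_ac K q).ae_le (ae_restrict_mem S.measurableSet))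
    rw [Measure.map_sum measurable_fst.aemeasurable]
    refine Eq.trans ?_ (h2.symm.trans h3)
    congr 1
    ext1 i
    rw [Measure.map_map measurable_fst (hpair i)]
    exact Measure.map_id
  have hsnd : π.map Prod.snd = empiricalMeasure x := by
    rw [Measure.map_sum measurable_snd.aemeasurable, empiricalMeasure, Finset.smul_sum,
      ← Measure.sum_fintype]
    congr 1
    ext1 i
    rw [Measure.map_map measurable_snd (hpair i)]
    change Measure.map (fun _ => x i) _ = _
    rw [Measure.map_const, Measure.restrict_apply_univ, hmassν]
  refine (iInf₂_le π ⟨hfst, hsnd⟩).trans ?_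
  have hφ := S.integrable_densityMeasure hq.1 (S.phi_continuousOn lam)
  have hcost : ∀ i, ∫⁻ z, ENNReal.ofReal (d z.1 z.2) ∂((ν.restrict (R i)).map fun y => (y, x i)) ≤
      ENNReal.ofReal ((∫ y in R i, phi d x lam y * q y) + lam i * (1 / N)) := by
    intro i
    refine (lintegral_map_le _ _).trans ?_
    have hint : Integrable (fun y => phi d x lam y + lam i) (ν.restrict (R i)) :=
      (hφ.add (integrable_const _)).integrableOn
    have heq : ∀ y ∈ R i, d y (x i) = phi d x lam y + lam i := fun y hy => by
      rw [S.phi_eq_of_mem_voronoiRegion hy]; ring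
    have h0 : 0 ≤ᵐ[ν.restrict (R i)] fun y => phi d x lam y + lam i := by
      filter_upwards [ae_restrict_mem (hRm i)] with y hy
      rw [Pi.zero_apply, ← heq y hy]
      exact S.dist_nonneg (hRK i hy) (S.mem i)
    rw [setLIntegral_congr_fun (hRm i)
        (g := fun y => ENNReal.ofReal (phi d x lam y + lam i))
        (fun y hy => by simp only [heq y hy]),
      ← ofReal_integral_eq_lintegral_ofReal hint h0,
      integral_add hφ.integrableOn (integrable_const _),
      setIntegral_densityMeasure hq.1 (hRm i) (hRK i),
      setIntegral_densityMeasure hq.1 (hRm i) (hRK i), integral_const_mul, hmass i]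
  have hnn : ∀ i, 0 ≤ (∫ y in R i, phi d x lam y * q y) + lam i * (1 / N) := by
    intro i
    have h1 := S.integrableOn_mul (S.phi_continuousOn lam) hq.1.1
    rw [← hmass i, ← integral_const_mul, ← integral_add (h1.mono_set (hRK i))
      ((hq.1.1.mono_set (hRK i)).const_mul _)]
    refine integral_nonneg_of_ae ?_
    filter_upwards [ae_restrict_mem (hRm i),
      ae_restrict_of_ae_restrict_of_subset (hRK i) hq.1.2] with y hy hqy
    rw [Pi.zero_apply, ← add_mul, S.phi_eq_of_mem_voronoiRegion hy, sub_add_cancel]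
    exact mul_nonneg (S.dist_nonneg (hRK i hy) (S.mem i)) hqy
  calc ∫⁻ z in K ×ˢ K, ENNReal.ofReal (d z.1 z.2) ∂π
      ≤ ∫⁻ z, ENNReal.ofReal (d z.1 z.2) ∂π := setLIntegral_le_lintegral _ _
    _ = ∑ i, ∫⁻ z, ENNReal.ofReal (d z.1 z.2) ∂((ν.restrict (R i)).map fun y => (y, x i)) := by
        rw [lintegral_sum_measure, tsum_fintype]
    _ ≤ ∑ i, ENNReal.ofReal ((∫ y in R i, phi d x lam y * q y) + lam i * (1 / N)) :=
        Finset.sum_le_sum fun i _ => hcost i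
    _ = ENNReal.ofReal (∫ y in K, phi d x lam y * q y) := by
        have hs : ∑ i, lam i = 0 := hlam
        rw [← ENNReal.ofReal_sum_of_nonneg fun i _ => hnn i, Finset.sum_add_distrib,
          ← Finset.sum_mul, hs, zero_mul, add_zero, S.sum_setIntegral_voronoiRegion lam
            (S.integrableOn_mul (S.phi_continuousOn lam) hq.1.1)]

/-- The Kantorovich functional `λ ↦ ∫ φ_λ q` has a maximizer on `Λ`. -/
lemma exists_forall_integral_phi_le (S : Setting K d x p) (hq : q ∈ densities K) :
    ∃ lam ∈ weightSpace N, ∀ lam' ∈ weightSpace N,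
      ∫ y in K, phi d x lam' y * q y ≤ ∫ y in K, phi d x lam y * q y := by
  have := S.nonempty
  have hint : ∀ lam : Fin N → ℝ, IntegrableOn (fun y => phi d x lam y * q y) K := fun lam =>
    S.integrableOn_mul (S.phi_continuousOn lam) hq.1.1
  have hconc : ConcaveOn ℝ Set.univ fun lam : Fin N → ℝ => ∫ y in K, phi d x lam y * q y := by
    refine ⟨convex_univ, fun l1 _ l2 _ a b ha hb hab => ?_⟩
    simp only [smul_eq_mul]
    rw [← integral_const_mul, ← integral_const_mul,
      ← integral_add ((hint l1).const_mul a) ((hint l2).const_mul b)]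
    refine integral_mono_ae (((hint l1).const_mul a).add ((hint l2).const_mul b)) (hint _) ?_
    filter_upwards [hq.1.2] with y hy
    have h := psi_add_le (d := d) (x := x) (a • (1, l1)) (b • (1, l2)) y
    rw [psi_smul ha, psi_smul hb, ← phi_eq_psi, ← phi_eq_psi, Prod.smul_mk, Prod.smul_mk,
      Prod.mk_add_mk, ← add_smul, hab, one_smul, ← phi_eq_psi] at h
    have := mul_le_mul_of_nonneg_right h hy
    linarith
  have hcont := continuousOn_univ.1 (hconc.continuousOn isOpen_univ)
  have hclosed : IsClosed (weightSpace N) :=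
    isClosed_eq (continuous_finsetSum _ fun i _ => continuous_apply i) continuous_const
  have h0 : (0 : Fin N → ℝ) ∈ weightSpace N := by simp [weightSpace]
  set a : Fin N → ℝ := fun i => ∫ y in K, d y (x i) * q y with ha
  obtain ⟨i₀, hi₀⟩ := Finite.exists_max a
  set A := a i₀ - ∫ y in K, phi d x 0 y * q y with hA
  refine exists_forall_le_of_bounded_superlevel hcont hclosed h0 (N * A + A) fun lam hlam hle => ?_
  have hlamA : ∀ i, lam i ≤ A := by
    intro i
    have hdi : IntegrableOn (fun y => d y (x i) * q y) K :=
      S.integrableOn_mul (S.continuousOn_dist i) hq.1.1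
    have h1 : ∫ y in K, phi d x lam y * q y ≤ a i - lam i := by
      have h2 : a i - lam i = ∫ y in K, (d y (x i) * q y - lam i * q y) := by
        rw [integral_sub hdi (hq.1.1.const_mul _), integral_const_mul, hq.2, mul_one]
      rw [h2]
      refine integral_mono_ae (hint lam) (hdi.sub (hq.1.1.const_mul _)) ?_
      filter_upwards [hq.1.2] with y hy
      have := mul_le_mul_of_nonneg_right (phi_le (d := d) (x := x) lam y i) hy
      linarith
    have := hi₀ i
    linarith
  have hs : ∑ i, lam i = 0 := hlam
  have hsum : ∑ i, (A - lam i) = N * A := by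
    rw [Finset.sum_sub_distrib, hs]; simp
  have hNA : 0 ≤ N * A := by
    rw [← hsum]; exact Finset.sum_nonneg fun i _ => sub_nonneg.2 (hlamA i)
  have hA0 : 0 ≤ A := nonneg_of_mul_nonneg_right hNA (by exact_mod_cast S.pos)
  rw [pi_norm_le_iff_of_nonneg (by linarith)]
  intro i
  have h3 := Finset.single_le_sum (f := fun k => A - lam k)
    (fun k _ => sub_nonneg.2 (hlamA k)) (Finset.mem_univ i)
  have := hlamA i
  rw [Real.norm_eq_abs, abs_le]
  constructor <;> linarith

/-- At a maximizer of the Kantorovich functional all Voronoi regions carry the mass `1/N`: raising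
`λᵢ` shows that each region carries at least `1/N`, and the masses add up to one. -/
lemma setIntegral_voronoiRegion_eq (S : Setting K d x p) (hq : q ∈ densities K)
    (hlam : lam ∈ weightSpace N) (hmax : ∀ lam' ∈ weightSpace N,
      ∫ y in K, phi d x lam' y * q y ≤ ∫ y in K, phi d x lam y * q y) (i : Fin N) :
    ∫ y in voronoiRegion K d x lam i, q y = 1 / N := by
  classical
  have := S.nonempty
  have hN : (0 : ℝ) < N := by exact_mod_cast S.pos
  have hs : ∑ i, lam i = 0 := hlam
  have hge : ∀ i, 1 / (N : ℝ) ≤ ∫ y in voronoiRegion K d x lam i, q y := by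
    intro i
    -- `A t` is the region of `xᵢ` enlarged by the tolerance `t`.
    let A : ℝ → Set (EuclideanSpace ℝ (Fin n)) := fun t =>
      K ∩ (fun y => d y (x i) - lam i - phi d x lam y) ⁻¹' Set.Iic t
    have hAm : ∀ t, MeasurableSet (A t) := fun t =>
      ((((S.continuousOn_dist i).sub continuousOn_const).sub
        (S.phi_continuousOn lam)).preimage_isClosed_of_isClosed S.isCompact.isClosed
          isClosed_Iic).measurableSet
    have key : ∀ t : ℝ, 0 < t → 1 / (N : ℝ) ≤ ∫ y in A t, q y := by
      intro t ht
      -- Raise the `i`-th weight by `t`, then recentre to stay in `Λ`.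
      let η : Fin N → ℝ := fun j => (lam j + if j = i then t else 0) - t / N
      have hη : η ∈ weightSpace N := by
        simp only [weightSpace, Set.mem_ofPred_eq, η, Finset.sum_sub_distrib,
          Finset.sum_add_distrib, hs, Finset.sum_ite_eq', Finset.mem_univ, if_true]
        simp
        field_simp
        simp
      have h1 := hmax η hη
      have hle : ∀ y ∈ K, phi d x lam y + t / N - t * (A t).indicator 1 y ≤ phi d x η y := by
        intro y hy
        refine le_phi fun j => ?_
        have h2 := phi_le (d := d) (x := x) lam y j
        have h01 : (0 : ℝ) ≤ (A t).indicator 1 y := Set.indicator_nonneg (by simp) y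
        by_cases hji : j = i
        · subst hji
          simp only [η, if_true]
          by_cases hyA : y ∈ A t
          · rw [Set.indicator_of_mem hyA, Pi.one_apply]; linarith
          · rw [Set.indicator_of_notMem hyA]
            have h3 : ¬ d y (x j) - lam j - phi d x lam y ≤ t := fun h => hyA ⟨hy, h⟩
            linarith
        · simp only [η, if_neg hji]
          have := mul_nonneg ht.le h01
          linarith
      have hiφ := S.integrableOn_mul (S.phi_continuousOn lam) hq.1.1
      have hiη := S.integrableOn_mul (S.phi_continuousOn η) hq.1.1
      have hiA : IntegrableOn ((A t).indicator q) K := hq.1.1.indicator (hAm t)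
      have h4 : ∫ y in K, (phi d x lam y * q y + t / N * q y - t * (A t).indicator q y) ≤
          ∫ y in K, phi d x η y * q y := by
        refine integral_mono_ae ((hiφ.add (hq.1.1.const_mul _)).sub (hiA.const_mul _)) hiη ?_
        filter_upwards [hq.1.2, ae_restrict_mem S.measurableSet] with y hy hyK
        have h5 := mul_le_mul_of_nonneg_right (hle y hyK) hy
        have h6 : (A t).indicator q y = (A t).indicator 1 y * q y := by
          by_cases hyA : y ∈ A t <;> simp [hyA]
        simp only [h6]
        linarith
      rw [integral_sub (f := fun y => phi d x lam y * q y + t / N * q y)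
          (hiφ.add (hq.1.1.const_mul _)) (hiA.const_mul _),
        integral_add hiφ (hq.1.1.const_mul _), integral_const_mul, integral_const_mul, hq.2,
        setIntegral_indicator (hAm t), show K ∩ A t = A t from
          Set.inter_eq_right.2 Set.inter_subset_left] at h4
      have h7 : t * (1 / N) ≤ t * ∫ y in A t, q y := by
        have : t * (1 / (N : ℝ)) = t / N * 1 := by ring
        linarith
      exact le_of_mul_le_mul_left h7 ht
    have hanti : Antitone fun k : ℕ => A (1 / ((k : ℝ) + 1)) := by
      intro k l hkl y hy
      refine ⟨hy.1, Set.mem_preimage.2 (Set.mem_Iic.2 (le_trans hy.2 ?_))⟩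
      exact one_div_le_one_div_of_le (by positivity) (by simpa using hkl)
    have hlim := tendsto_setIntegral_of_antitone (f := q) (μ := volume)
      (fun k : ℕ => hAm (1 / ((k : ℝ) + 1))) hanti ⟨0, hq.1.1.mono_set Set.inter_subset_left⟩
    have hInter : ⋂ k : ℕ, A (1 / ((k : ℝ) + 1)) = voronoiRegion K d x lam i := by
      ext y
      rw [Set.mem_iInter]
      constructor
      · intro h
        refine mem_voronoiRegion_of_phi_eq (h 0).1 (le_antisymm (phi_le lam y i) ?_)
        have h8 : d y (x i) - lam i - phi d x lam y ≤ 0 :=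
          ge_of_tendsto' tendsto_one_div_add_atTop_nhds_zero_nat fun k => (h k).2
        linarith
      · intro h k
        refine ⟨h.1, ?_⟩
        rw [Set.mem_preimage, Set.mem_Iic, S.phi_eq_of_mem_voronoiRegion h, sub_self]
        positivity
    rw [hInter] at hlim
    exact ge_of_tendsto' hlim fun k => key _ (by positivity)
  have hsum := S.sum_setIntegral_voronoiRegion lam hq.1.1
  rw [hq.2] at hsum
  have hsumN : ∑ _i : Fin N, 1 / (N : ℝ) = 1 := by
    simp
    field_simp
  exact ((Finset.sum_eq_sum_iff_of_le fun j _ => hge j).1 (hsumN.trans hsum.symm) i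
    (Finset.mem_univ i)).symm

/-- The strong half of Kantorovich duality: the transport cost is attained by some `φ_λ`, so a bound
on all `∫ φ_λ q` bounds it. -/
lemma wasserstein_le_of_forall_integral_phi_le (S : Setting K d x p) (hq : q ∈ densities K) {c : ℝ}
    (h : ∀ lam ∈ weightSpace N, ∫ y in K, phi d x lam y * q y ≤ c) :
    wasserstein K d (densityMeasure K q) (empiricalMeasure x) ≤ ENNReal.ofReal c := by
  obtain ⟨lam, hlam, hmax⟩ := S.exists_forall_integral_phi_le hq
  exact (S.wasserstein_le_of_setIntegral_eq hq hlam
    (S.setIntegral_voronoiRegion_eq hq hlam hmax)).trans (ENNReal.ofReal_le_ofReal (h lam hlam))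

lemma mem_wassersteinBall_iff (S : Setting K d x p) (hδ : 0 ≤ δ) :
    q ∈ wassersteinBall K d x δ ↔ ∀ lam ∈ weightSpace N, q ∈ feasibleSet K d x δ lam := by
  have h0 : (0 : Fin N → ℝ) ∈ weightSpace N := by simp [weightSpace]
  constructor
  · rintro ⟨hq, hW⟩ lam hlam
    exact ⟨hq, (ENNReal.ofReal_le_ofReal_iff hδ).1
      ((S.ofReal_integral_phi_le_wasserstein hq hlam).trans hW)⟩
  · intro h
    exact ⟨(h 0 h0).1, S.wasserstein_le_of_forall_integral_phi_le (h 0 h0).1 fun lam hlam =>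
      (h lam hlam).2⟩

end Setting

/-! ### Uniqueness of the parameters -/

namespace Setting

variable {n N : ℕ} {K : Set (EuclideanSpace ℝ (Fin n))}
  {d : EuclideanSpace ℝ (Fin n) → EuclideanSpace ℝ (Fin n) → ℝ}
  {x : Fin N → EuclideanSpace ℝ (Fin n)} {p : EuclideanSpace ℝ (Fin n) → ℝ} {δ : ℝ}
  {lam : Fin N → ℝ} {u v : ℝ}

lemma dist_pos (S : Setting K d x p) {y : EuclideanSpace ℝ (Fin n)} (hy : y ∈ K) {i : Fin N}
    (hne : y ≠ x i) : 0 < d y (x i) :=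
  (S.dist_nonneg hy (S.mem i)).lt_of_ne fun h =>
    hne ((S.metric.eq_zero_iff y hy _ (S.mem i)).1 h.symm)

/-- A region of positive volume meets every conull subset of `K`. -/
lemma exists_mem_voronoiRegion_of_ae {i : Fin N} (hR : volume (voronoiRegion K d x lam i) ≠ 0)
    (hK : MeasurableSet K) {P : EuclideanSpace ℝ (Fin n) → Prop}
    (hP : ∀ᵐ y ∂(volume.restrict K), P y) : ∃ y ∈ voronoiRegion K d x lam i, P y := by
  by_contra! hne
  rw [ae_restrict_iff' hK, ae_iff] at hP
  exact hR (measure_mono_null (fun y hy => fun h => hne y hy (h hy.1)) hP)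

/-- In positive dimension no site is isolated in `K`. -/
lemma exists_ne_of_eventually [Nontrivial (EuclideanSpace ℝ (Fin n))] (S : Setting K d x p)
    (i : Fin N) {P : EuclideanSpace ℝ (Fin n) → Prop} (hP : ∀ᶠ y in nhdsWithin (x i) K, P y) :
    ∃ y ∈ K, y ≠ x i ∧ P y := by
  obtain ⟨V, hV, hxV, hVP⟩ := mem_nhdsWithin.1 hP
  by_contra! hne
  have hsub : V ∩ K ⊆ {x i} := by
    intro y hy
    by_contra hyx
    exact hne y hy.2 hyx (hVP hy)
  exact (S.volume_pos hV hxV (S.mem i)).ne' (measure_mono_null hsub (measure_singleton _))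

/-- A site that lies in the interior of its own region has a neighbourhood in `K` on which `φ_λ`
is the distance to this site, up to a constant. -/
lemma eventually_phi_eq (S : Setting K d x p) {i : Fin N}
    (h : ∀ j, j ≠ i → lam j - lam i < d (x i) (x j)) :
    ∀ᶠ y in nhdsWithin (x i) K, phi d x lam y = d y (x i) - lam i := by
  have := S.nonempty
  have hev : ∀ j, ∀ᶠ y in nhdsWithin (x i) K, d y (x i) - lam i ≤ d y (x j) - lam j := by
    intro j
    by_cases hj : j = i
    · subst hj; exact Filter.Eventually.of_forall fun _ => le_rfl
    · have hc : ContinuousWithinAt (fun y => d y (x j) - d y (x i)) K (x i) :=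
        ((S.continuousOn_dist j).sub (S.continuousOn_dist i)) _ (S.mem i)
      have hlt : lam j - lam i < d (x i) (x j) - d (x i) (x i) := by
        rw [S.dist_self, sub_zero]; exact h j hj
      filter_upwards [hc.eventually (lt_mem_nhds hlt)] with y hy
      linarith
  filter_upwards [Filter.eventually_all.2 hev] with y hy
  exact le_antisymm (phi_le lam y i) (le_phi hy)

/-- A region of positive volume contains its site in its interior. -/
lemma sub_lt_dist_of_volume_ne_zero (S : Setting K d x p) {i : Fin N}
    (hR : volume (voronoiRegion K d x lam i) ≠ 0) {j : Fin N} (hj : j ≠ i) :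
    lam j - lam i < d (x i) (x j) := by
  obtain ⟨y, hy, hne⟩ := exists_mem_voronoiRegion_of_ae hR S.measurableSet
    (S.ae_ne hj (lam j - lam i))
  have h1 := S.metric.triangle y hy.1 (x i) (S.mem i) (x j) (S.mem j)
  have h2 : lam j - lam i < d y (x j) - d y (x i) :=
    lt_of_le_of_ne (by linarith [hy.2 j]) (Ne.symm hne)
  linarith

/-- The function `v φ_λ + u` on `K` determines its parameters, as soon as one representation has
`v > 0` and all regions of positive volume. Near a site `xᵢ` with `λ'ᵢ` maximal both
representations are affine in `d(·, xᵢ)`, which gives `v' = v`; no sign of `v'` is assumed. Then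
`φ_λ'` and `φ_λ` differ by a constant, and the nullity of the loci `d(·, xᵢ) - d(·, xⱼ) = t`
forces `λ' = λ`. -/
lemma parameters_eq [Nontrivial (EuclideanSpace ℝ (Fin n))] (S : Setting K d x p)
    {lam lam' : Fin N → ℝ} (hlam : lam ∈ weightSpace N) (hlam' : lam' ∈ weightSpace N)
    {u v u' v' : ℝ} (hv : 0 < v) (hR : ∀ i, volume (voronoiRegion K d x lam i) ≠ 0)
    (h : ∀ y ∈ K, v' * phi d x lam' y + u' = v * phi d x lam y + u) :
    lam' = lam ∧ u' = u ∧ v' = v := by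
  have := S.nonempty
  have hloc : ∀ i, ∀ᶠ y in nhdsWithin (x i) K, phi d x lam y = d y (x i) - lam i := fun i =>
    S.eventually_phi_eq fun j hj => S.sub_lt_dist_of_volume_ne_zero (hR i) hj
  have hat : ∀ i, phi d x lam (x i) = -lam i := by
    intro i
    rw [(hloc i).self_of_nhdsWithin (S.mem i), S.dist_self, zero_sub]
  -- At a site of maximal weight `λ'ᵢ` no other site is closer in the weighted sense, so both
  -- functions have explicit local expressions there.
  obtain ⟨i, hi⟩ := Finite.exists_max lam'
  have hloc' : ∀ᶠ y in nhdsWithin (x i) K, phi d x lam' y = d y (x i) - lam' i := by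
    refine S.eventually_phi_eq fun j hj => ?_
    have := S.dist_pos (S.mem i) (S.injective.ne hj.symm)
    have := hi j
    linarith
  have hat' : phi d x lam' (x i) = -lam' i := by
    rw [hloc'.self_of_nhdsWithin (S.mem i), S.dist_self, zero_sub]
  obtain ⟨y, hyK, hyne, hy, hy'⟩ := S.exists_ne_of_eventually i ((hloc i).and hloc')
  have hvv : v' = v := by
    have e1 := h y hyK
    have e2 := h (x i) (S.mem i)
    rw [hy, hy'] at e1
    rw [hat, hat'] at e2
    have e3 : v' * d y (x i) = v * d y (x i) := by linarith
    exact mul_right_cancel₀ (S.dist_pos hyK hyne).ne' e3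
  subst hvv
  obtain ⟨c, hc⟩ : ∃ c, c = (u - u') / v' := ⟨_, rfl⟩
  have hφ : ∀ y ∈ K, phi d x lam' y = phi d x lam y + c := by
    intro y hy
    have := h y hy
    rw [hc]
    field_simp
    linarith
  have hlc : ∀ i, lam' i = lam i - c := by
    intro i
    by_contra hne
    have hae : ∀ᵐ y ∂(volume.restrict K), ∀ j, i ≠ j →
        d y (x i) - d y (x j) ≠ lam i - c - lam' j := by
      rw [ae_all_iff]
      intro j
      by_cases hij : i = j
      · exact Filter.Eventually.of_forall fun _ h => absurd hij h
      · filter_upwards [S.ae_ne hij (lam i - c - lam' j)] with y hy _ using hy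
    obtain ⟨y, hyR, hy⟩ := exists_mem_voronoiRegion_of_ae (hR i) S.measurableSet hae
    obtain ⟨j, hj⟩ := exists_phi_eq d x lam' y
    have h1 := hφ y hyR.1
    rw [S.phi_eq_of_mem_voronoiRegion hyR, hj] at h1
    by_cases hij : i = j
    · subst hij
      exact hne (by linarith)
    · exact hy j hij (by linarith)
  have hs : ∑ i, lam i = 0 := hlam
  have hs' : ∑ i, lam' i = 0 := hlam'
  have hc0 : c = 0 := by
    have h1 : ∑ i, lam' i = ∑ i, (lam i - c) := Finset.sum_congr rfl fun i _ => hlc i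
    rw [Finset.sum_sub_distrib, hs, hs'] at h1
    have hN : (N : ℝ) ≠ 0 := by exact_mod_cast S.pos.ne'
    simpa [hN] using h1
  subst hc0
  refine ⟨funext fun i => by rw [hlc i, sub_zero], ?_, rfl⟩
  have h1 := h (x i) (S.mem i)
  rw [hφ _ (S.mem i), add_zero] at h1
  linarith

/-! ### The optimal parameters -/

lemma mem_densities (S : Setting K d x p) : p ∈ densities K :=
  ⟨⟨S.integrableOn_p, by
    filter_upwards [ae_restrict_mem S.measurableSet] with y hy using (S.ppos y hy).le⟩, S.pint⟩

/-- Maximality of `(λ, u, v)` in the dual problems of all `Γ(λ')` simultaneously. -/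
structure IsJointMaximizer (K : Set (EuclideanSpace ℝ (Fin n)))
    (d : EuclideanSpace ℝ (Fin n) → EuclideanSpace ℝ (Fin n) → ℝ)
    (x : Fin N → EuclideanSpace ℝ (Fin n)) (p : EuclideanSpace ℝ (Fin n) → ℝ) (δ : ℝ)
    (lam : Fin N → ℝ) (u v : ℝ) : Prop where
  mem : lam ∈ weightSpace N
  nonneg : 0 ≤ v
  le : ∀ lam' ∈ weightSpace N, ∀ u' v' : ℝ, 0 ≤ v' →
    dualObjective K d x p δ lam' (u', v') ≤ dualObjective K d x p δ lam (u, v)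

lemma IsJointMaximizer.isDualMaximizer (h : IsJointMaximizer K d x p δ lam u v) :
    IsDualMaximizer K d x p δ lam u v :=
  ⟨h.nonneg, h.le lam h.mem⟩

lemma exists_mem_weightSpace_eq (hN : 0 < N) {θ : ℝ × (Fin N → ℝ)} (hθ : 0 < θ.1) :
    ∃ lam ∈ weightSpace N, ∃ u : ℝ, θ = (θ.1, fun i => θ.1 * lam i - u) := by
  have hN' : (N : ℝ) ≠ 0 := by exact_mod_cast hN.ne'
  refine ⟨fun i => (θ.2 i - (∑ j, θ.2 j) / N) / θ.1, ?_, -((∑ j, θ.2 j) / N), ?_⟩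
  · simp only [weightSpace, Set.mem_ofPred_eq]
    rw [← Finset.sum_div, Finset.sum_sub_distrib]
    simp
    left
    field_simp
    simp
  · ext1
    · rfl
    · ext i
      simp only
      field_simp
      ring

lemma dualObjective_zero_nonpos (S : Setting K d x p) (δ : ℝ) (lam : Fin N → ℝ) (u : ℝ) :
    dualObjective K d x p δ lam (u, 0) ≤ 0 := by
  simp only [dualObjective, zero_mul, add_zero, integral_mul_const, S.pint, one_mul, sub_zero]
  have := Real.add_one_le_exp (-(1 + u))
  linarith

section FarCenter

variable (S : Setting K d x p)
  (hW : ENNReal.ofReal δ < wasserstein K d (densityMeasure K p) (empiricalMeasure x))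

include S hW

lemma exists_lt_integral_phi : ∃ lam ∈ weightSpace N, δ < ∫ y in K, phi d x lam y * p y := by
  by_contra! h
  exact absurd (S.wasserstein_le_of_forall_integral_phi_le S.mem_densities h) (not_le.2 hW)

lemma nontrivial (hδ : 0 < δ) : Nontrivial (EuclideanSpace ℝ (Fin n)) := by
  by_contra hnt
  have hsub : Subsingleton (EuclideanSpace ℝ (Fin n)) := not_nontrivial_iff_subsingleton.1 hnt
  obtain ⟨lam, hlam, h⟩ := S.exists_lt_integral_phi hW
  have hs : ∑ i, lam i = 0 := hlam
  have hphi : ∀ y, phi d x lam y ≤ 0 := by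
    intro y
    have h1 : ∀ i, phi d x lam y ≤ -lam i := fun i => by
      have := phi_le (d := d) (x := x) lam y i
      rwa [Subsingleton.elim y (x i), S.dist_self, zero_sub, ← Subsingleton.elim y (x i)] at this
    have h2 := Finset.sum_le_sum fun i (_ : i ∈ Finset.univ) => h1 i
    rw [Finset.sum_neg_distrib, hs] at h2
    have hN : (0 : ℝ) < N := by exact_mod_cast S.pos
    simp only [Finset.sum_const, Finset.card_univ, Fintype.card_fin, nsmul_eq_mul, neg_zero] at h2
    exact nonpos_of_mul_nonpos_right h2 hN
  have : ∫ y in K, phi d x lam y * p y ≤ 0 :=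
    setIntegral_nonpos S.measurableSet fun y hy =>
      mul_nonpos_of_nonpos_of_nonneg (hphi y) (S.ppos y hy).le
  linarith

/-- Some dual value is positive: otherwise `(u, v) = (-1, 0)`, whose dual value is `0` and whose
density is `p`, would be a maximizer for every `λ`. -/
lemma exists_dualObjective_pos :
    ∃ lam ∈ weightSpace N, ∃ u v : ℝ, 0 ≤ v ∧ 0 < dualObjective K d x p δ lam (u, v) := by
  obtain ⟨lam, hlam, h⟩ := S.exists_lt_integral_phi hW
  refine ⟨lam, hlam, ?_⟩
  by_contra! hle
  have h0 : dualObjective K d x p δ lam (-1, 0) = 0 := by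
    simp [dualObjective, S.pint]
  have hmax : IsDualMaximizer K d x p δ lam (-1) 0 :=
    ⟨le_rfl, fun u' v' hv' => (hle u' v' hv').trans_eq h0.symm⟩
  have hp : expDensity d x p lam (-1) 0 = p := by
    ext y; simp [expDensity]
  have := (S.kkt_of_isDualMaximizer hmax).2.1
  rw [hp] at this
  linarith

lemma IsJointMaximizer.pos (h : IsJointMaximizer K d x p δ lam u v) : 0 < v := by
  obtain ⟨lam₀, hlam₀, u₀, v₀, hv₀, hpos⟩ := S.exists_dualObjective_pos hW
  refine h.nonneg.lt_of_ne fun h0 => ?_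
  subst h0
  have h1 := h.le lam₀ hlam₀ u₀ v₀ hv₀
  have h2 := S.dualObjective_zero_nonpos δ lam u
  linarith

lemma exists_isJointMaximizer (hδ : 0 < δ) :
    ∃ (lam : Fin N → ℝ) (u v : ℝ), IsJointMaximizer K d x p δ lam u v := by
  have := S.nonempty
  have hN : (0 : ℝ) < N := by exact_mod_cast S.pos
  obtain ⟨θ, hθ, hmax⟩ := S.exists_forall_jointDual_le hδ
  have hθ' : 0 < θ.1 := by
    refine hθ.lt_of_ne fun h0 => ?_
    obtain ⟨lam₀, hlam₀, u₀, v₀, hv₀, hpos⟩ := S.exists_dualObjective_pos hW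
    rw [S.dualObjective_eq_jointDual δ hlam₀ u₀ hv₀] at hpos
    have h1 := hpos.trans_le (hmax _ (by exact hv₀))
    obtain ⟨i, hi⟩ := Finite.exists_max θ.2
    have hm : (∑ j, θ.2 j) / N ≤ θ.2 i := by
      rw [div_le_iff₀ hN]
      calc ∑ j, θ.2 j ≤ ∑ _j : Fin N, θ.2 i := Finset.sum_le_sum fun j _ => hi j
        _ = θ.2 i * N := by simp [mul_comm]
    have h2 : Real.exp (θ.2 i - 1) ≤ ∫ y in K, gibbs d x p θ y := by
      have h3 : ∫ y in K, p y * Real.exp (θ.2 i - 1) = Real.exp (θ.2 i - 1) := by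
        rw [integral_mul_const, S.pint, one_mul]
      rw [← h3]
      refine setIntegral_mono_on (S.integrableOn_p.mul_const _) (S.gibbs_integrableOn θ)
        S.measurableSet fun y hy => ?_
      refine mul_le_mul_of_nonneg_left (Real.exp_le_exp.2 ?_) (S.ppos y hy).le
      have := psi_le (d := d) (x := x) θ y i
      rw [← h0, zero_mul] at this
      linarith
    rw [jointDual, ← h0] at h1
    have h3 := Real.add_one_le_exp (θ.2 i - 1)
    linarith
  obtain ⟨lam, hlam, u, hu⟩ := exists_mem_weightSpace_eq S.pos hθ'
  refine ⟨lam, u, θ.1, hlam, hθ, fun lam' hlam' u' v' hv' => ?_⟩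
  rw [S.dualObjective_eq_jointDual δ hlam' u' hv', S.dualObjective_eq_jointDual δ hlam u hθ, ← hu]
  exact hmax _ hv'

end FarCenter

/-- A joint maximizer yields the unique density of minimum cross-entropy in the ball: by the
first-order conditions its exponential density is feasible for every `λ'`, hence lies in the ball,
and the ball is contained in `Ω(λ)`, where that density is already the unique minimizer. -/
lemma IsJointMaximizer.isOptimalParameter (S : Setting K d x p) (hδ : 0 < δ)
    (h : IsJointMaximizer K d x p δ lam u v) : IsOptimalParameter K d x p δ lam u v := by
  have hdm := h.isDualMaximizer
  have hfeas := S.expDensity_mem_feasibleSet hdm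
  have hball : expDensity d x p lam u v ∈ wassersteinBall K d x δ := by
    rw [S.mem_wassersteinBall_iff hδ.le]
    refine fun lam' hlam' => ⟨hfeas.1, ?_⟩
    rw [S.expDensity_eq_gibbs lam u h.nonneg]
    refine S.integral_phi_gibbs_le (θ := (v, fun i => v * lam i - u)) h.nonneg ?_ hlam'
    intro η hη
    obtain ⟨lam₁, hlam₁, u₁, hu₁⟩ := exists_mem_weightSpace_eq S.pos hη
    rw [hu₁, ← S.dualObjective_eq_jointDual δ hlam₁ u₁ hη.le,
      ← S.dualObjective_eq_jointDual δ h.mem u h.nonneg]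
    exact h.le lam₁ hlam₁ u₁ η.1 hη.le
  have hsub : ∀ q ∈ wassersteinBall K d x δ, q ∈ feasibleSet K d x δ lam := fun q hq =>
    (S.mem_wassersteinBall_iff hδ.le).1 hq lam h.mem
  refine ⟨h.mem, hball, fun q hq => ?_, fun q hq heq => ?_⟩
  · rw [S.crossEntropy_expDensity_of_isDualMaximizer hdm]
    exact S.dualObjective_le_crossEntropy (hsub q hq) u h.nonneg
  · rw [S.crossEntropy_expDensity_of_isDualMaximizer hdm] at heq
    exact S.ae_eq_expDensity_of_crossEntropy_le (hsub q hq) h.nonneg heq.le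

lemma IsJointMaximizer.volume_voronoiRegion_ne_zero (S : Setting K d x p) (hδ : 0 < δ)
    (h : IsJointMaximizer K d x p δ lam u v) (hv : 0 < v) (i : Fin N) :
    volume (voronoiRegion K d x lam i) ≠ 0 := by
  have hdm := h.isDualMaximizer
  obtain ⟨-, -, hslack⟩ := S.kkt_of_isDualMaximizer hdm
  have hδeq : ∫ y in K, phi d x lam y * expDensity d x p lam u v y = δ := by
    have := (mul_eq_zero.1 hslack).resolve_left hv.ne'
    linarith
  have hball := (h.isOptimalParameter S hδ).2.1
  have hmass := S.setIntegral_voronoiRegion_eq hball.1 h.mem (fun lam' hlam' => by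
    rw [hδeq]
    exact ((S.mem_wassersteinBall_iff hδ.le).1 hball lam' hlam').2) i
  intro h0
  rw [setIntegral_measure_zero _ h0] at hmass
  have hN : (0 : ℝ) < N := by exact_mod_cast S.pos
  have : 0 < 1 / (N : ℝ) := by positivity
  linarith

/-- All optimal parameters agree with a given joint maximizer. -/
lemma IsJointMaximizer.eq_of_isOptimalParameter (S : Setting K d x p) (hδ : 0 < δ)
    (hW : ENNReal.ofReal δ < wasserstein K d (densityMeasure K p) (empiricalMeasure x))
    (h : IsJointMaximizer K d x p δ lam u v) {lam' : Fin N → ℝ} {u' v' : ℝ}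
    (h' : IsOptimalParameter K d x p δ lam' u' v') : lam' = lam ∧ u' = u ∧ v' = v := by
  have := S.nontrivial hW hδ
  have hv := IsJointMaximizer.pos S hW h
  have ho := (h.isOptimalParameter S hδ).2
  have hae : expDensity d x p lam' u' v' =ᵐ[volume.restrict K] expDensity d x p lam u v :=
    ho.2.2 _ h'.2.1 (le_antisymm (h'.2.2.1 _ ho.1) (ho.2.1 _ h'.2.1))
  have heq := S.eqOn_of_ae_eq (S.expDensity_continuousOn lam' u' v')
    (S.expDensity_continuousOn lam u v) hae
  refine S.parameters_eq h.mem h'.1 hv (h.volume_voronoiRegion_ne_zero S hδ hv) fun y hy => ?_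
  have h1 := heq hy
  rw [expDensity_apply, expDensity_apply] at h1
  have h2 := Real.exp_injective (mul_left_cancel₀ (S.ppos y hy).ne' h1)
  linarith

lemma IsJointMaximizer.gamMaximizers_eq (S : Setting K d x p) (hδ : 0 < δ)
    (hW : ENNReal.ofReal δ < wasserstein K d (densityMeasure K p) (empiricalMeasure x))
    (h : IsJointMaximizer K d x p δ lam u v) : gamMaximizers K d x p δ = {lam} := by
  apply Set.Subset.antisymm
  · rintro lam' ⟨hlam', hmax⟩
    obtain ⟨u', v', huv'⟩ := S.exists_isDualMaximizer hδ hlam'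
    have h1 := hmax lam h.mem
    rw [S.gam_eq_dualObjective huv', S.gam_eq_dualObjective h.isDualMaximizer,
      EReal.coe_le_coe_iff] at h1
    have h2 : IsJointMaximizer K d x p δ lam' u' v' :=
      ⟨hlam', huv'.1, fun lam₁ hlam₁ u₁ v₁ hv₁ => (h.le lam₁ hlam₁ u₁ v₁ hv₁).trans h1⟩
    exact (h.eq_of_isOptimalParameter S hδ hW (h2.isOptimalParameter S hδ)).1
  · rintro _ rfl
    refine ⟨h.mem, fun lam' hlam' => ?_⟩
    obtain ⟨u', v', huv'⟩ := S.exists_isDualMaximizer hδ hlam'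
    rw [S.gam_eq_dualObjective huv', S.gam_eq_dualObjective h.isDualMaximizer,
      EReal.coe_le_coe_iff]
    exact h.le lam' hlam' u' v' huv'.1

/-- The cutting plane: if `⟨g, λ' - λ⟩ < 0` then the minimizer of `Γ(λ)` satisfies the constraint of
`Γ(λ')` strictly, and weak duality for `λ'` with its positive multiplier gives `Γ(λ') < Γ(λ)`. -/
lemma gamMaximizers_subset (S : Setting K d x p) (hδ : 0 < δ)
    (hW : ENNReal.ofReal δ < wasserstein K d (densityMeasure K p) (empiricalMeasure x))
    (hlam : lam ∈ weightSpace N) (h : IsDualMaximizer K d x p δ lam u v) :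
    gamMaximizers K d x p δ ⊆
      {lam' ∈ weightSpace N | 0 ≤ cutVector K d x p lam u v ⬝ᵥ (lam' - lam)} := by
  rintro lam' ⟨hlam', hmax⟩
  refine ⟨hlam', ?_⟩
  by_contra! hneg
  obtain ⟨u', v', h'⟩ := S.exists_isDualMaximizer hδ hlam'
  have hle : ∀ lam₁ ∈ weightSpace N, ∀ u₁ v₁ : ℝ, IsDualMaximizer K d x p δ lam₁ u₁ v₁ →
      dualObjective K d x p δ lam₁ (u₁, v₁) ≤ dualObjective K d x p δ lam' (u', v') := by
    intro lam₁ hlam₁ u₁ v₁ h₁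
    have := hmax lam₁ hlam₁
    rwa [S.gam_eq_dualObjective h₁, S.gam_eq_dualObjective h', EReal.coe_le_coe_iff] at this
  have hv' : 0 < v' := by
    refine h'.1.lt_of_ne fun h0 => ?_
    obtain ⟨lam₀, hlam₀, u₀, v₀, hv₀, hpos⟩ := S.exists_dualObjective_pos hW
    obtain ⟨u₁, v₁, h₁⟩ := S.exists_isDualMaximizer hδ hlam₀
    have e1 := h₁.2 u₀ v₀ hv₀
    have e2 := hle lam₀ hlam₀ u₁ v₁ h₁
    have e3 := S.dualObjective_zero_nonpos δ lam' u'
    rw [h0] at e3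
    linarith
  obtain ⟨-, hfeas, -⟩ := S.kkt_of_isDualMaximizer h
  have hstrict : (∫ y in K, phi d x lam' y * expDensity d x p lam u v y) - δ < 0 := by
    have h1 := S.integral_phi_le_add (S.expDensity_mem_nonnegCone lam u v) lam lam'
    have hs : ∑ i, lam i = 0 := hlam
    have hs' : ∑ i, lam' i = 0 := hlam'
    have h2 : cutVector K d x p lam u v ⬝ᵥ (lam' - lam) =
        -∑ i, (lam' i - lam i) * ∫ y in voronoiRegion K d x lam i, expDensity d x p lam u v y := by
      have h3 : ∑ i, 1 / (N : ℝ) * (lam' i - lam i) = 0 := by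
        rw [← Finset.mul_sum, Finset.sum_sub_distrib, hs, hs', sub_zero, mul_zero]
      rw [dotProduct, ← zero_sub, ← h3, ← Finset.sum_sub_distrib]
      refine Finset.sum_congr rfl fun i _ => ?_
      simp only [cutVector, Pi.sub_apply]
      ring
    linarith
  -- Weak duality for `λ'`, evaluated at the minimizer of `Γ(λ)`.
  have h4 := S.dualObjective_le_crossEntropy_add (S.expDensity_mem_feasibleSet h).1 δ lam' u' v'
  rw [S.crossEntropy_expDensity_of_isDualMaximizer h, ← EReal.coe_add, EReal.coe_le_coe_iff] at h4
  have h5 := mul_neg_of_pos_of_neg hv' hstrict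
  have h6 := hle lam hlam u v h
  linarith

end Setting

end MinCrossEntropy

theorem theorem1p3 {n N : ℕ} (hN : 0 < N)
    (K : Set (EuclideanSpace ℝ (Fin n))) (hK : IsRegularCompact K)
    (d : EuclideanSpace ℝ (Fin n) → EuclideanSpace ℝ (Fin n) → ℝ)
    (hd : IsContinuousMetricOn K d)
    (x : Fin N → EuclideanSpace ℝ (Fin n)) (hx : ∀ i, x i ∈ K)
    (hnull : ∀ i j, i ≠ j → ∀ t : ℝ, volume {y ∈ K | d y (x i) - d y (x j) = t} = 0)
    (p : EuclideanSpace ℝ (Fin n) → ℝ) (hpcont : ContinuousOn p K)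
    (hppos : ∀ y ∈ K, 0 < p y) (hpint : ∫ y in K, p y = 1)
    (δ : ℝ) (hδ : 0 < δ) :
    -- (1) strong duality, with the explicit concave two-variable dual problem
    (∀ lam ∈ weightSpace N,
      (∀ u v : ℝ, 0 ≤ v →
        dualFunction K d x p δ lam u v = ((dualObjective K d x p δ lam (u, v) : ℝ) : EReal)) ∧
      ConcaveOn ℝ {w : ℝ × ℝ | 0 ≤ w.2} (dualObjective K d x p δ lam) ∧
      (∃ q ∈ feasibleSet K d x δ lam, crossEntropy K q p = Gam K d x p δ lam) ∧
      ∃ u v : ℝ, IsDualMaximizer K d x p δ lam u v ∧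
        Gam K d x p δ lam = ((dualObjective K d x p δ lam (u, v) : ℝ) : EReal)) ∧
    -- (2) the cutting plane
    (ENNReal.ofReal δ < wasserstein K d (densityMeasure K p) (empiricalMeasure x) →
      ∀ lam ∈ weightSpace N, ∀ u v : ℝ, IsDualMaximizer K d x p δ lam u v →
        gamMaximizers K d x p δ ⊆
          {lam' ∈ weightSpace N | 0 ≤ cutVector K d x p lam u v ⬝ᵥ (lam' - lam)}) ∧
    -- (3) quasi-concavity and the unique maximizer
    QuasiconcaveOn ℝ (weightSpace N) (Gam K d x p δ) ∧
    (ENNReal.ofReal δ < wasserstein K d (densityMeasure K p) (empiricalMeasure x) →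
      (∃! θ : (Fin N → ℝ) × ℝ × ℝ, IsOptimalParameter K d x p δ θ.1 θ.2.1 θ.2.2) ∧
      ∀ (lamStar : Fin N → ℝ) (u v : ℝ), IsOptimalParameter K d x p δ lamStar u v →
        gamMaximizers K d x p δ = {lamStar}) := by
  have S : Setting K d x p := ⟨hN, hK, hd, hx, hnull, hpcont, hppos, hpint⟩
  refine ⟨fun lam hlam => ?_, fun hW lam hlam u v h => S.gamMaximizers_subset hδ hW hlam h,
    S.quasiconcaveOn_gam δ, fun hW => ?_⟩
  · obtain ⟨u, v, h⟩ := S.exists_isDualMaximizer hδ hlam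
    exact ⟨fun u v _ => S.dualFunction_eq δ lam u v, S.concaveOn_dualObjective δ hlam,
      ⟨_, S.expDensity_mem_feasibleSet h, by
        rw [S.crossEntropy_expDensity_of_isDualMaximizer h, S.gam_eq_dualObjective h]⟩,
      u, v, h, S.gam_eq_dualObjective h⟩
  · obtain ⟨lam, u, v, h⟩ := S.exists_isJointMaximizer hW hδ
    refine ⟨⟨(lam, u, v), h.isOptimalParameter S hδ, ?_⟩, ?_⟩
    · rintro ⟨lam', u', v'⟩ h'
      obtain ⟨rfl, rfl, rfl⟩ := h.eq_of_isOptimalParameter S hδ hW h'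
      rfl
    · intro lamStar u' v' h'
      obtain ⟨rfl, -, -⟩ := h.eq_of_isOptimalParameter S hδ hW h'
      exact h.gamMaximizers_eq S hδ hW
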